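/- Let $n\ge 1$, $p\ge 2$ be integers and $\rho\in[0,1]$, and let $E=\binom{[n]}{2}$ be the set of two-element subsets of $[n]$. Draw $\pi^\star=(\pi^\star_1,\dots,\pi^\star_p)$ uniformly from $(\mathcal S_n)^p$ and, independently, i.i.d. $\mathcal N(0,1)$ variables $(H_{0,e})_{e\in E}$ and $(Z_{je})_{j\in[p],e\in E}$. One observes the graphs $G_1,\dots,G_p$ with edge weights $$G_{je}=\sqrt\rho\,H_{0,\Pi^\star_j(e)}+\sqrt{1-\rho}\,Z_{je},\qquad \Pi^\star_j(\{u,u'\})=\{\pi^\star_j(u),\pi^\star_j(u')\}.$$ The node alignment matrix $M^\star\in\mathbb R^{(n\times p)\times(n\times p)}$ is given by $M^\star_{(u,j),(u',j')}=\mathbf 1\{\pi^\star_j(u)=\pi^\star_{j'}(u')\}$. For an integer $D\ge 0$, put $$\mathrm{MMSE}_{\le D}=\inf_{\widehat M}\frac{1}{p(p-1)n^2}\,\mathbb E\big[\|\widehat M-M^\star\|_F^2\big],$$ where the infimum is over all matrices $\widehat M$ whose entries are polynomials of total degree at most $D$ in the variables $(G_{je})_{j\in[p],e\in E}$. 1.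 If $\rho<1$, $D\le n-2$ and $$\zeta:=\frac{D^3\sqrt\rho}{1-\sqrt\rho}\,\sqrt{1+D/2}\;\frac{2}{\big(1-\frac{D+1}{n}\big)^2}<1,$$ then $$\mathrm{MMSE}_{\le D}\ \ge\ \frac1n-\frac1{n^2}-\frac{2}{(n-1-D)^2}\,\zeta\,\frac{1+\zeta}{1-\zeta}.$$ 2. The trivial estimator $\widehat M=\mathbb E[M^\star]$ satisfies $\frac{1}{p(p-1)n^2}\mathbb E\big[\|\mathbb E[M^\star]-M^\star\|_F^2\big]=\frac1n-\frac1{n^2}$. 3. Let $\eta>0$, and let $n,p,D,\rho$ vary along a sequence with $n\geq 1$, $p\ge 2$, $\rho\in[0,1]$, $np\to\infty$, $D=O\big(\log(np)^{1+\eta}\big)$ and $\rho=o\big(\log(np)^{-7(1+\eta)}\big)$. Then $$\mathrm{MMSE}_{\le D}=\frac1n-\frac1{n^2}\,(1+o(1)).$$ -/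

import Mathlib

namespace GraphAlignment

open MeasureTheory ProbabilityTheory

/-- The set `E` of edges on the vertex set `[n]`: all two-element subsets of `Fin n`. -/
abbrev Edge (n : ℕ) : Type := {e : Finset (Fin n) // e.card = 2}

/-- The action of a node permutation on edges, `{u, u'} ↦ {π u, π u'}`. -/
def permEdge {n : ℕ} (π : Equiv.Perm (Fin n)) (e : Edge n) : Edge n :=
  ⟨e.1.map π.toEmbedding, by rw [Finset.card_map]; exact e.2⟩

/-- The finite group of permutations carries the discrete σ-algebra. -/
instance instMeasurableSpacePermFin (n : ℕ) : MeasurableSpace (Equiv.Perm (Fin n)) := ⊤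

/-- All the randomness of the model: the hidden permutations `π⋆ = (π⋆₁, …, π⋆ₚ)`, the signal
graph `H₀` and the noise graphs `Z₁, …, Zₚ`. -/
abbrev Latent (n p : ℕ) : Type :=
  (Fin p → Equiv.Perm (Fin n)) × (Edge n → ℝ) × (Fin p → Edge n → ℝ)

/-- The law of the latent variables: `π⋆` is uniform on `(𝒮ₙ)ᵖ`, all edge weights of `H₀` and of
`Z₁, …, Zₚ` are standard Gaussian, and everything is independent. -/
noncomputable def latentLaw (n p : ℕ) : Measure (Latent n p) :=
  (PMF.uniformOfFintype (Fin p → Equiv.Perm (Fin n))).toMeasure.prod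
    ((Measure.pi fun _ : Edge n => gaussianReal 0 1).prod
      (Measure.pi fun _ : Fin p => Measure.pi fun _ : Edge n => gaussianReal 0 1))

/-- The observed weights `G_{je} = √ρ H₀_{Π⋆ⱼ(e)} + √(1-ρ) Z_{je}`. -/
noncomputable def observation {n p : ℕ} (ρ : ℝ) (ω : Latent n p) (i : Fin p × Edge n) : ℝ :=
  Real.sqrt ρ * ω.2.1 (permEdge (ω.1 i.1) i.2) + Real.sqrt (1 - ρ) * ω.2.2 i.1 i.2

/-- The node alignment matrix `M⋆_{(u,j),(u',j')} = 1{π⋆ⱼ(u) = π⋆ⱼ'(u')}`. -/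
noncomputable def alignmentMatrix {n p : ℕ} (ω : Latent n p) :
    Matrix (Fin n × Fin p) (Fin n × Fin p) ℝ :=
  Matrix.of fun a b => if ω.1 a.2 a.1 = ω.1 b.2 b.1 then 1 else 0

/-- A matrix whose entries are polynomials in the observed edge weights of `G₁, …, Gₚ`. -/
abbrev PolyEstimator (n p : ℕ) : Type :=
  Matrix (Fin n × Fin p) (Fin n × Fin p) (MvPolynomial (Fin p × Edge n) ℝ)

/-- The normalized mean squared error `E ‖M̂ - M⋆‖_F² / (p (p - 1) n²)`. -/
noncomputable def mse {n p : ℕ} (ρ : ℝ) (M : PolyEstimator n p) : ℝ :=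
  1 / ((p : ℝ) * ((p : ℝ) - 1) * (n : ℝ) ^ 2) *
    ∫ ω, ∑ a, ∑ b, (MvPolynomial.eval (observation ρ ω) (M a b) - alignmentMatrix ω a b) ^ 2
      ∂(latentLaw n p)

/-- The degree-`D` minimum mean squared error: the infimum of the mean squared error over all
estimators whose entries are polynomials of total degree at most `D` in the observations. -/
noncomputable def mmse (n p : ℕ) (ρ : ℝ) (D : ℕ) : ℝ :=
  ⨅ M : {M : PolyEstimator n p // ∀ a b, (M a b).totalDegree ≤ D}, mse ρ M.1

/-- The trivial estimator `E[M⋆]`, which does not look at the data. -/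
noncomputable def trivialEstimator (n p : ℕ) : PolyEstimator n p :=
  Matrix.of fun a b => MvPolynomial.C (∫ ω, alignmentMatrix ω a b ∂(latentLaw n p))

/-- The quantity `ζ = D³√ρ/(1-√ρ) · √(1+D/2) · 2/(1-(D+1)/n)²`. -/
noncomputable def zeta (n D : ℕ) (ρ : ℝ) : ℝ :=
  (D : ℝ) ^ 3 * Real.sqrt ρ / (1 - Real.sqrt ρ) * Real.sqrt (1 + (D : ℝ) / 2) *
    (2 / (1 - ((D : ℝ) + 1) / (n : ℝ)) ^ 2)

end GraphAlignment

/-! Fix an entry `(u, j), (u', j')` with `j ≠ j'` and reveal every permutation except `σ = π j`. An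
estimator of degree at most `D` then becomes a polynomial `f` of degree at most `D` in `H₀`, the
weights of `G_j` and the noises of the other graphs. These are standard Gaussian variables whose
only correlations are `r = √ρ` between `G_{je}` and `H₀` at `σ e`. The target is the indicator of `σ
u = v`, where `v = π j' u'` is known.

Let `L₀` be the expectation under independence and `L σ` the one given `σ`. Gaussian interpolation
gives `L σ f = L₀ (exp (r Δ_σ) f)`, where `Δ_σ` contracts each `G_{je}` with `H₀` at `σ e`
(`IsStein.eq_sum_pairLaplacian`). With `g = f - 1/n` and `y` the centred indicator, the average
error is `A - 2 B + 1/n - 1/n²`, where `A` averages `L σ (g²)` and `B` averages `y σ * L σ g`. It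
remains to show that `A` is at least a constant times `M = L₀ (g²)`, and that `B²` is at most a
small multiple of `M / n²`.

Both follow from a bound on the terms of order `m ≥ 1` in the averaged exponential. Such a term is a
sum of derivatives of `g` along pairs of `m`-tuples of edges, with coefficients `E[y σ 1{σ s = s'}]`
(with `y = 1` for `A`). By Cauchy-Schwarz, the derivatives cost `D^(2m) M` in mean square
(`IsStein.sum_pderiv_le`). The sum of the squared coefficients is controlled through Burnside's
lemma (`sum_sq_card_tuple_le`): it counts orbits of `m`-tuples of edges under the stabilizer of `u`,
and these are at most `D^(2m)` in number because a tuple touches at most `2m` vertices. The centred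
indicator gains a further factor `2/n²`. The order `m` term thus has relative size `(r D²)^m`, which
is summable (`linkRemainder_sq_le`). For `A`, Parseval and Jensen reduce to the same operator
(`average_map_mul_self_ge`).

The resulting bound `mmse_ge` has no restriction of `D` by `n`. It yields the asymptotic claim
directly, and the claim in `ζ` because `ζ` dominates `5 √ρ D²` when `D ≥ 2`. -/

namespace GraphAlignment

open MvPolynomial MeasureTheory ProbabilityTheory

set_option linter.unusedSectionVars false

/-! ### Gaussian expectations of polynomials by Stein's identity, and Parseval -/

section Algebra

variable {I : Type*}

/-- Induction on the total degree, building polynomials by multiplication by a variable. -/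
theorem totalDegree_induction {P : ℕ → MvPolynomial I ℝ → Prop}
    (hC : ∀ N a, P N (C a)) (hadd : ∀ N f g, P N f → P N g → P N (f + g))
    (hX : ∀ N j f, f.totalDegree ≤ N → (∀ g : MvPolynomial I ℝ, g.totalDegree ≤ N → P N g) →
      P (N + 1) (X j * f)) :
    ∀ N (f : MvPolynomial I ℝ), f.totalDegree ≤ N → P N f := by
  intro N
  induction N with
  | zero =>
    intro f hf
    rw [totalDegree_eq_zero_iff_eq_C.1 (Nat.le_zero.1 hf)]
    exact hC _ _
  | succ N ih =>
    intro f hf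
    have key : ∀ s ∈ f.support, P (N + 1) (monomial s (f.coeff s)) := by
      intro s hs
      have hdeg : (s.sum fun _ e => e) ≤ N + 1 := (le_totalDegree hs).trans hf
      by_cases h0 : s = 0
      · subst h0
        exact hC _ _
      · obtain ⟨j, hj⟩ := Finsupp.ne_iff.1 h0
        have hj' : Finsupp.single j 1 ≤ s := by
          rw [Finsupp.single_le_iff]
          exact Nat.one_le_iff_ne_zero.2 hj
        have hs' : s = Finsupp.single j 1 + (s - Finsupp.single j 1) :=
          (add_tsub_cancel_of_le hj').symm
        have hmon : monomial s (f.coeff s) =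
            X j * monomial (s - Finsupp.single j 1) (f.coeff s) := by
          rw [X, monomial_mul, one_mul, ← hs']
        rw [hmon]
        refine hX N j _ ?_ ih
        refine (totalDegree_monomial_le _ _).trans ?_
        have := hdeg
        rw [hs', Finsupp.sum_add_index' (by simp) (by simp), Finsupp.sum_single_index rfl] at this
        simp only [Finsupp.sum] at this ⊢
        simp only [Function.id_def] at *
        omega
    rw [f.as_sum]
    refine Finset.sum_induction _ (P (N + 1)) (hadd _) ?_ key
    simpa using hC (N + 1) 0

theorem totalDegree_pderiv_le_of_le_succ (i : I) (f : MvPolynomial I ℝ) {N : ℕ}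
    (hf : f.totalDegree ≤ N + 1) : (pderiv i f).totalDegree ≤ N := by
  refine Finset.sup_le fun m hm => ?_
  have h1 : m + Finsupp.single i 1 ∈ f.support := by
    rw [mem_support_iff, coeff_pderiv] at hm
    exact mem_support_iff.2 (left_ne_zero_of_mul hm)
  have h2 := (le_totalDegree h1).trans hf
  rw [Finsupp.sum_add_index' (by simp) (by simp), Finsupp.sum_single_index rfl] at h2
  exact Nat.le_of_succ_le_succ h2

theorem pderiv_comm (i j : I) (f : MvPolynomial I ℝ) :
    pderiv i (pderiv j f) = pderiv j (pderiv i f) := by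
  classical
  ext m
  simp only [coeff_pderiv]
  by_cases h : i = j
  · subst h; rfl
  · simp [add_right_comm, h, Ne.symm h]
    ring

theorem totalDegree_pderiv_le (i : I) (f : MvPolynomial I ℝ) {N : ℕ} (hf : f.totalDegree ≤ N) :
    (pderiv i f).totalDegree ≤ N :=
  totalDegree_pderiv_le_of_le_succ i f (hf.trans N.le_succ)

theorem pderiv_X_mul [DecidableEq I] (i j : I) (f : MvPolynomial I ℝ) :
    pderiv i (X j * f) = X j * pderiv i f + (if i = j then f else 0) := by
  rw [pderiv_mul, pderiv_X, Pi.single_apply, add_comm]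
  congr 1
  by_cases h : i = j
  · simp [h]
  · simp [h, Ne.symm h]

variable [Fintype I]

/-- A functional on polynomials satisfies Stein's identity for the covariance `Γ`: it is then the
expectation under a centred Gaussian vector with this covariance. -/
structure IsStein (Γ : I → I → ℝ) (L : MvPolynomial I ℝ →ₗ[ℝ] ℝ) : Prop where
  one : L 1 = 1
  X_mul : ∀ j f, L (X j * f) = ∑ i, Γ j i * L (pderiv i f)

/-- The contribution `∑ Γ i₁ j₁ ⋯ Γ iₖ jₖ L(∂i₁ ⋯ ∂iₖ f) L(∂j₁ ⋯ ∂jₖ g)` of the `k`-th chaos to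
the Gaussian inner product of `f` and `g`, up to the factor `k!`. -/
noncomputable def chaosForm (Γ : I → I → ℝ) (L : MvPolynomial I ℝ →ₗ[ℝ] ℝ) :
    ℕ → MvPolynomial I ℝ →ₗ[ℝ] MvPolynomial I ℝ →ₗ[ℝ] ℝ
  | 0 => (LinearMap.mul ℝ ℝ).compl₁₂ L L
  | k + 1 => ∑ i, ∑ j, Γ i j • (chaosForm Γ L k).compl₁₂
      (pderiv i).toLinearMap (pderiv j).toLinearMap

variable {Γ : I → I → ℝ} {L : MvPolynomial I ℝ →ₗ[ℝ] ℝ}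

theorem chaosForm_zero (f g : MvPolynomial I ℝ) : chaosForm Γ L 0 f g = L f * L g := rfl

theorem chaosForm_succ (k : ℕ) (f g : MvPolynomial I ℝ) :
    chaosForm Γ L (k + 1) f g =
      ∑ i, ∑ j, Γ i j * chaosForm Γ L k (pderiv i f) (pderiv j g) := by
  simp [chaosForm, LinearMap.sum_apply]

theorem chaosForm_comm (h : ∀ i j, Γ i j = Γ j i) (k : ℕ) (f g : MvPolynomial I ℝ) :
    chaosForm Γ L k f g = chaosForm Γ L k g f := by
  induction k generalizing f g with
  | zero => simp [chaosForm_zero, mul_comm]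
  | succ k ih =>
    rw [chaosForm_succ, chaosForm_succ, Finset.sum_comm]
    refine Finset.sum_congr rfl fun i _ => Finset.sum_congr rfl fun j _ => ?_
    rw [h, ih]

theorem chaosForm_eq_zero_of_totalDegree_lt (k : ℕ) (f g : MvPolynomial I ℝ)
    (hf : f.totalDegree < k) : chaosForm Γ L k f g = 0 := by
  induction k generalizing f g with
  | zero => exact absurd hf (Nat.not_lt_zero _)
  | succ k ih =>
    rw [chaosForm_succ]
    refine Finset.sum_eq_zero fun i _ => Finset.sum_eq_zero fun j _ => ?_
    rcases Nat.eq_zero_or_pos k with rfl | hk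
    · rw [totalDegree_eq_zero_iff_eq_C.1 (Nat.lt_one_iff.1 hf)]
      simp
    · rw [ih, mul_zero]
      obtain ⟨k, rfl⟩ : ∃ l, k = l + 1 := ⟨k - 1, by omega⟩
      exact Nat.lt_succ_of_le (totalDegree_pderiv_le_of_le_succ i f (Nat.le_of_lt_succ hf))

/-- By the Leibniz rule, either none of the `k` derivatives hits `X j`, and Stein's identity removes
it, or exactly one does, and its contraction with `Γ` leaves a derivative on `g`. At `k = 0` the
truncated `k - 1` is harmless because of the factor `k`. -/
theorem chaosForm_X_mul (h : IsStein Γ L) (k : ℕ) (j : I) (f g : MvPolynomial I ℝ) :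
    chaosForm Γ L k (X j * f) g = ∑ i, Γ j i * chaosForm Γ L k (pderiv i f) g +
      k * ∑ i, Γ j i * chaosForm Γ L (k - 1) f (pderiv i g) := by
  classical
  induction k generalizing f g with
  | zero => simp [chaosForm_zero, h.X_mul, Finset.sum_mul, mul_assoc]
  | succ k ih =>
    have h1 : ∀ i l, Γ i l * chaosForm Γ L k (pderiv i (X j * f)) (pderiv l g) =
        ∑ r, Γ j r * (Γ i l * chaosForm Γ L k (pderiv i (pderiv r f)) (pderiv l g)) +
        k * ∑ r, Γ j r * (Γ i l * chaosForm Γ L (k - 1) (pderiv i f) (pderiv l (pderiv r g))) +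
        if i = j then Γ i l * chaosForm Γ L k f (pderiv l g) else 0 := by
      intro i l
      rw [pderiv_X_mul, map_add, LinearMap.add_apply, ih, mul_add, mul_add]
      congr 1
      · congr 1
        · rw [Finset.mul_sum]
          exact Finset.sum_congr rfl fun r _ => by rw [pderiv_comm]; ring
        · rw [mul_left_comm, Finset.mul_sum]
          congr 1
          exact Finset.sum_congr rfl fun r _ => by rw [pderiv_comm]; ring
      · split_ifs <;> simp
    rw [chaosForm_succ]
    simp only [h1, Finset.sum_add_distrib]
    rw [add_assoc]
    congr 1
    · simp only [chaosForm_succ, Finset.mul_sum]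
      exact Finset.sum_comm_cycle
    · have h2 : ∑ i, ∑ l, (if i = j then Γ i l * chaosForm Γ L k f (pderiv l g) else 0) =
          ∑ l, Γ j l * chaosForm Γ L k f (pderiv l g) := by
        rw [Finset.sum_comm]
        simp
      have h3 : (k : ℝ) * ∑ r, Γ j r * chaosForm Γ L k f (pderiv r g) =
          ∑ i, ∑ l, k * ∑ r, Γ j r *
            (Γ i l * chaosForm Γ L (k - 1) (pderiv i f) (pderiv l (pderiv r g))) := by
        rcases Nat.eq_zero_or_pos k with rfl | hk
        · simp
        · obtain ⟨k, rfl⟩ : ∃ l, k = l + 1 := ⟨k - 1, by omega⟩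
          simp only [chaosForm_succ, Nat.add_sub_cancel, ← Finset.mul_sum]
          congr 1
          simp only [Finset.mul_sum]
          exact Finset.sum_comm_cycle.symm
      rw [h2, ← h3, Nat.add_sub_cancel]
      push_cast
      ring

/-- Parseval's identity for the chaos expansion. -/
theorem IsStein.map_mul (h : IsStein Γ L) (D : ℕ) : ∀ N (f : MvPolynomial I ℝ),
    f.totalDegree ≤ N → N ≤ D → ∀ g, L (f * g) =
      ∑ k ∈ Finset.range (D + 1), (k.factorial : ℝ)⁻¹ * chaosForm Γ L k f g := by
  refine totalDegree_induction ?_ ?_ ?_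
  · intro N a _ g
    rw [Finset.sum_range_succ', Finset.sum_eq_zero, C_mul', map_smul, chaosForm_zero]
    · have : (MvPolynomial.C a : MvPolynomial I ℝ) = a • 1 := by rw [← C_mul', mul_one]
      simp [this, h.one]
    · intro k _
      rw [chaosForm_eq_zero_of_totalDegree_lt _ _ _ (by simp), mul_zero]
  · intro N f f' hf hf' hN g
    rw [add_mul, map_add, hf hN, hf' hN, ← Finset.sum_add_distrib]
    simp [mul_add]
  · intro N j f hf ih hN g
    have h1 : ∀ i, L (pderiv i (f * g)) =
        ∑ k ∈ Finset.range (D + 1), (k.factorial : ℝ)⁻¹ * chaosForm Γ L k (pderiv i f) g +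
        ∑ k ∈ Finset.range (D + 1), (k.factorial : ℝ)⁻¹ * chaosForm Γ L k f (pderiv i g) := by
      intro i
      rw [pderiv_mul, map_add, ih _ (totalDegree_pderiv_le i f hf) (by omega),
        ih f hf (by omega)]
    rw [mul_assoc, h.X_mul]
    simp only [h1, chaosForm_X_mul h, mul_add, Finset.sum_add_distrib]
    congr 1
    · simp only [Finset.mul_sum]
      rw [Finset.sum_comm]
      exact Finset.sum_congr rfl fun k _ => Finset.sum_congr rfl fun i _ => by ring
    -- The shift `k / k! = 1 / (k - 1)!` matches the two sums. The term `k = D` left over on one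
    -- side vanishes because `f` has degree below `D`.
    · rw [Finset.sum_range_succ']
      simp only [Finset.sum_range_succ _ D, Nat.cast_zero, zero_mul, mul_zero, add_zero,
        chaosForm_eq_zero_of_totalDegree_lt D f _ (by omega), Finset.mul_sum, Nat.add_sub_cancel,
        Finset.sum_const_zero]
      rw [Finset.sum_comm]
      refine Finset.sum_congr rfl fun k _ => Finset.sum_congr rfl fun i _ => ?_
      rw [Nat.factorial_succ]
      have : ((k : ℝ) + 1) ≠ 0 := by positivity
      have : (k.factorial : ℝ) ≠ 0 := by positivity
      push_cast
      field_simp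

end Algebra

/-! ### Linked covariances: lower bound and expansion in the correlation -/

section Algebra

variable {I E : Type*} [Fintype I] [Fintype E]

/-- The covariance of independent standard Gaussian variables. -/
def stdCov [DecidableEq I] (i j : I) : ℝ := if i = j then 1 else 0

/-- The covariance of standard Gaussian variables in which `α e` and `β e` have correlation `r`
for each `e`. -/
def linkCov [DecidableEq I] (r : ℝ) (α β : E → I) (i j : I) : ℝ :=
  stdCov i j + r * ∑ e, (stdCov (α e) i * stdCov (β e) j + stdCov (β e) i * stdCov (α e) j)

variable [DecidableEq I]

theorem sum_stdCov_mul (i : I) (x : I → ℝ) : ∑ j, stdCov i j * x j = x i := by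
  simp [stdCov]

theorem stdCov_comm (i j : I) : stdCov i j = stdCov j i := by
  simp [stdCov, eq_comm]

theorem linkCov_comm (r : ℝ) (α β : E → I) (i j : I) :
    linkCov r α β i j = linkCov r α β j i := by
  simp only [linkCov, stdCov_comm i j]
  congr 2
  exact Finset.sum_congr rfl fun e _ => by ring

theorem sum_linkCov_mul (r : ℝ) (α β : E → I) (j : I) (x : I → ℝ) :
    ∑ i, linkCov r α β j i * x i =
      x j + r * ∑ e, (stdCov (α e) j * x (β e) + stdCov (β e) j * x (α e)) := by
  have h : ∀ e, ∑ i, (stdCov (α e) j * stdCov (β e) i + stdCov (β e) j * stdCov (α e) i) * x i =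
      stdCov (α e) j * x (β e) + stdCov (β e) j * x (α e) := by
    intro e
    simp only [add_mul, Finset.sum_add_distrib, mul_assoc, ← Finset.mul_sum, sum_stdCov_mul]
  simp only [linkCov, add_mul, Finset.sum_add_distrib (s := (Finset.univ : Finset I)),
    sum_stdCov_mul, mul_assoc, ← Finset.mul_sum, Finset.sum_mul]
  rw [Finset.sum_comm]
  simp only [← h, add_mul, mul_assoc, Finset.mul_sum]

variable {L : MvPolynomial I ℝ →ₗ[ℝ] ℝ}

theorem chaosForm_stdCov_succ (k : ℕ) (f g : MvPolynomial I ℝ) :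
    chaosForm stdCov L (k + 1) f g =
      ∑ i, chaosForm stdCov L k (pderiv i f) (pderiv i g) := by
  simp only [chaosForm_succ, sum_stdCov_mul]

theorem chaosForm_stdCov_nonneg (k : ℕ) (f : MvPolynomial I ℝ) :
    0 ≤ chaosForm stdCov L k f f := by
  induction k generalizing f with
  | zero => exact mul_self_nonneg _
  | succ k ih =>
    rw [chaosForm_stdCov_succ]
    exact Finset.sum_nonneg fun i _ => ih _

theorem chaosForm_linkCov_succ (r : ℝ) (α β : E → I) (k : ℕ) (f : MvPolynomial I ℝ) :
    chaosForm (linkCov r α β) L (k + 1) f f =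
      ∑ i, chaosForm (linkCov r α β) L k (pderiv i f) (pderiv i f) +
        r * ∑ e, 2 * chaosForm (linkCov r α β) L k (pderiv (α e) f) (pderiv (β e) f) := by
  rw [chaosForm_succ]
  simp only [sum_linkCov_mul, Finset.sum_add_distrib (s := (Finset.univ : Finset I)),
    ← Finset.mul_sum]
  rw [Finset.sum_comm]
  congr 2
  rw [Finset.mul_sum]
  refine Finset.sum_congr rfl fun e _ => ?_
  rw [Finset.sum_add_distrib, sum_stdCov_mul, sum_stdCov_mul,
    chaosForm_comm (linkCov_comm r α β) k (pderiv (β e) f)]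
  ring

/-- Links of correlation `r` have a covariance that is at least `1 - r` times the identity. -/
theorem chaosForm_linkCov_ge {r : ℝ} (hr : 0 ≤ r) (hr' : r ≤ 1) {α β : E → I}
    (hαβ : Function.Injective (Sum.elim α β)) (k : ℕ) (f : MvPolynomial I ℝ) :
    (1 - r) ^ k * chaosForm stdCov L k f f ≤ chaosForm (linkCov r α β) L k f f := by
  induction k generalizing f with
  | zero => simp [chaosForm_zero]
  | succ k ih =>
    have h0 : ∀ g, 0 ≤ chaosForm (linkCov r α β) L k g g := fun g =>
      (mul_nonneg (pow_nonneg (by linarith) _) (chaosForm_stdCov_nonneg k g)).trans (ih g)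
    set Q := chaosForm (linkCov r α β) L k with hQ
    -- Positivity of `Q` at `∂_α f + ∂_β f`. The links are disjoint, so in `h2` each variable is
    -- charged at most once.
    have h1 : ∀ e, -(Q (pderiv (α e) f) (pderiv (α e) f) + Q (pderiv (β e) f) (pderiv (β e) f)) ≤
        2 * Q (pderiv (α e) f) (pderiv (β e) f) := by
      intro e
      have := h0 (pderiv (α e) f + pderiv (β e) f)
      rw [map_add, map_add, LinearMap.add_apply, LinearMap.add_apply, hQ,
        chaosForm_comm (linkCov_comm r α β) k (pderiv (β e) f) (pderiv (α e) f), ← hQ] at this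
      linarith
    have h2 : ∑ e, (Q (pderiv (α e) f) (pderiv (α e) f) + Q (pderiv (β e) f) (pderiv (β e) f)) ≤
        ∑ i, Q (pderiv i f) (pderiv i f) := by
      have h3 := Finset.sum_le_sum_of_subset_of_nonneg
        (Finset.subset_univ (Finset.univ.map ⟨Sum.elim α β, hαβ⟩))
        (f := fun i => Q (pderiv i f) (pderiv i f)) (fun i _ _ => h0 _)
      rw [Finset.sum_map, Fintype.sum_sum_type] at h3
      rw [Finset.sum_add_distrib]
      exact h3
    have h3 : -(∑ i, Q (pderiv i f) (pderiv i f)) ≤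
        ∑ e, 2 * Q (pderiv (α e) f) (pderiv (β e) f) := by
      refine (neg_le_neg h2).trans ?_
      rw [← Finset.sum_neg_distrib]
      exact Finset.sum_le_sum fun e _ => h1 e
    have h4 : (1 - r) ^ k * ∑ i, chaosForm stdCov L k (pderiv i f) (pderiv i f) ≤
        ∑ i, Q (pderiv i f) (pderiv i f) := by
      rw [Finset.mul_sum]
      exact Finset.sum_le_sum fun i _ => ih _
    rw [chaosForm_linkCov_succ, chaosForm_stdCov_succ, pow_succ, ← hQ]
    have h5 := mul_le_mul_of_nonneg_left h3 hr
    have h6 := mul_le_mul_of_nonneg_left h4 (sub_nonneg.2 hr')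
    linarith

theorem IsStein.map_mul_self_ge {r : ℝ} (hr : 0 ≤ r) (hr' : r ≤ 1) {α β : E → I}
    (hαβ : Function.Injective (Sum.elim α β)) (h : IsStein (linkCov r α β) L) {D : ℕ}
    {f : MvPolynomial I ℝ} (hf : f.totalDegree ≤ D) :
    (1 - r) ^ D * ∑ k ∈ Finset.range (D + 1),
      (k.factorial : ℝ)⁻¹ * chaosForm stdCov L k f f ≤ L (f * f) := by
  rw [h.map_mul D D f hf le_rfl, Finset.mul_sum]
  refine Finset.sum_le_sum fun k hk => ?_
  rw [mul_left_comm]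
  refine mul_le_mul_of_nonneg_left ?_ (by positivity)
  refine le_trans ?_ (chaosForm_linkCov_ge hr hr' hαβ k f)
  exact mul_le_mul_of_nonneg_right (pow_le_pow_of_le_one (by linarith) (by linarith)
    (Nat.lt_succ_iff.1 (Finset.mem_range.1 hk))) (chaosForm_stdCov_nonneg k f)

theorem IsStein.map_mul_self_nonneg (h : IsStein stdCov L) (f : MvPolynomial I ℝ) :
    0 ≤ L (f * f) := by
  rw [h.map_mul _ _ f le_rfl le_rfl]
  exact Finset.sum_nonneg fun k _ => mul_nonneg (by positivity) (chaosForm_stdCov_nonneg k f)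

/-- On polynomials of degree at most `D` the Dirichlet form is at most `D` times the norm. -/
theorem IsStein.sum_pderiv_le (h : IsStein stdCov L) {D : ℕ} {f : MvPolynomial I ℝ}
    (hf : f.totalDegree ≤ D) :
    ∑ i, L (pderiv i f * pderiv i f) ≤ D * L (f * f) := by
  have h1 : ∀ i, L (pderiv i f * pderiv i f) = ∑ k ∈ Finset.range (D + 1),
      (k.factorial : ℝ)⁻¹ * chaosForm stdCov L k (pderiv i f) (pderiv i f) := fun i =>
    h.map_mul D D _ (totalDegree_pderiv_le i f hf) le_rfl _
  simp only [h1]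
  -- The order `k` part of the gradient is the order `k + 1` part of `f`, so the Dirichlet form
  -- multiplies the chaos of order `k + 1` by `k + 1 ≤ D`. The order `D + 1` part is zero.
  rw [Finset.sum_comm, h.map_mul D D f hf le_rfl, Finset.sum_range_succ, Finset.sum_range_succ']
  simp only [← Finset.mul_sum, ← chaosForm_stdCov_succ,
    chaosForm_eq_zero_of_totalDegree_lt (D + 1) f f (Nat.lt_succ_of_le hf), mul_zero, add_zero]
  rw [mul_add]
  refine le_add_of_le_of_nonneg ?_ (mul_nonneg (Nat.cast_nonneg _)
    (mul_nonneg (by positivity) (chaosForm_stdCov_nonneg _ _)))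
  rw [Finset.mul_sum]
  refine Finset.sum_le_sum fun k hk => ?_
  rw [← mul_assoc]
  refine mul_le_mul_of_nonneg_right ?_ (chaosForm_stdCov_nonneg _ _)
  rw [Nat.factorial_succ, Nat.cast_mul, mul_inv, ← mul_assoc]
  refine le_mul_of_one_le_left (by positivity) ?_
  rw [← div_eq_mul_inv, one_le_div (by positivity)]
  exact_mod_cast Nat.succ_le_of_lt (Finset.mem_range.1 hk)

/-- The second-order operator that contracts `α e` with `β e` for each `e`. -/
noncomputable def pairLaplacian (α β : E → I) : Module.End ℝ (MvPolynomial I ℝ) :=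
  ∑ e, (pderiv (α e)).toLinearMap ∘ₗ (pderiv (β e)).toLinearMap

theorem pairLaplacian_apply (α β : E → I) (f : MvPolynomial I ℝ) :
    pairLaplacian α β f = ∑ e, pderiv (α e) (pderiv (β e) f) := by
  simp [pairLaplacian, LinearMap.sum_apply]

theorem pairLaplacian_pow_pderiv (α β : E → I) (m : ℕ) (i : I) (f : MvPolynomial I ℝ) :
    (pairLaplacian α β ^ m) (pderiv i f) = pderiv i ((pairLaplacian α β ^ m) f) := by
  induction m generalizing f with
  | zero => simp
  | succ m ih =>
    have h1 : pairLaplacian α β (pderiv i f) = pderiv i (pairLaplacian α β f) := by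
      rw [pairLaplacian_apply, pairLaplacian_apply, map_sum]
      refine Finset.sum_congr rfl fun e _ => ?_
      rw [pderiv_comm (β e), pderiv_comm (α e)]
    rw [pow_succ, Module.End.mul_apply, Module.End.mul_apply, ← ih, h1]

theorem totalDegree_pairLaplacian_pow_le (α β : E → I) (m : ℕ) {f : MvPolynomial I ℝ} {N : ℕ}
    (hf : f.totalDegree ≤ N) : ((pairLaplacian α β ^ m) f).totalDegree ≤ N := by
  induction m generalizing f with
  | zero => simpa using hf
  | succ m ih =>
    rw [pow_succ, Module.End.mul_apply, pairLaplacian_apply]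
    refine ih ?_
    refine (totalDegree_finsetSum _ _).trans (Finset.sup_le fun e _ => ?_)
    exact totalDegree_pderiv_le _ _ (totalDegree_pderiv_le _ _ hf)

theorem pairLaplacian_pow_eq_zero (α β : E → I) (m : ℕ) {f : MvPolynomial I ℝ}
    (hf : f.totalDegree < 2 * m) : (pairLaplacian α β ^ m) f = 0 := by
  induction m generalizing f with
  | zero => omega
  | succ m ih =>
    rw [pow_succ, Module.End.mul_apply, pairLaplacian_apply]
    rcases Nat.eq_zero_or_pos m with rfl | hm
    · rw [map_sum]
      refine Finset.sum_eq_zero fun e _ => ?_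
      have h1 := totalDegree_pderiv_le_of_le_succ (N := 0) (β e) f (by omega)
      rw [totalDegree_eq_zero_iff_eq_C.1 (Nat.le_zero.1 h1)]
      simp
    · refine ih (lt_of_le_of_lt (totalDegree_finsetSum _ _) ?_)
      rw [Finset.sup_lt_iff (by simpa using hm)]
      intro e _
      have h1 := totalDegree_pderiv_le_of_le_succ (N := 2 * m) (β e) f (by omega)
      have h2 := totalDegree_pderiv_le_of_le_succ (N := 2 * m - 1) (α e) (pderiv (β e) f)
        (by omega)
      omega

/-- The commutator of the contraction `Δ` with multiplication by `X j` is a first-order operator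
with constant coefficients. It commutes with `Δ`, whence the factor `m` and the power `m - 1`. -/
theorem pairLaplacian_pow_X_mul (α β : E → I) (m : ℕ) (j : I) (f : MvPolynomial I ℝ) :
    (pairLaplacian α β ^ m) (X j * f) = X j * (pairLaplacian α β ^ m) f +
      m • ∑ e, (stdCov (α e) j • pderiv (β e) ((pairLaplacian α β ^ (m - 1)) f) +
        stdCov (β e) j • pderiv (α e) ((pairLaplacian α β ^ (m - 1)) f)) := by
  have h1 : ∀ f, pairLaplacian α β (X j * f) = X j * pairLaplacian α β f +
      ∑ e, (stdCov (α e) j • pderiv (β e) f + stdCov (β e) j • pderiv (α e) f) := by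
    intro f
    rw [pairLaplacian_apply, pairLaplacian_apply, Finset.mul_sum, ← Finset.sum_add_distrib]
    refine Finset.sum_congr rfl fun e _ => ?_
    rw [pderiv_X_mul, map_add, pderiv_X_mul, add_assoc]
    congr 1
    congr 1
    · simp [stdCov]
    · unfold stdCov; split_ifs <;> simp
  induction m generalizing f with
  | zero => simp
  | succ m ih =>
    rw [pow_succ', Module.End.mul_apply, ih, map_add, h1, Module.End.mul_apply, add_assoc]
    congr 1
    rw [succ_nsmul', Nat.add_sub_cancel]
    congr 1
    rcases Nat.eq_zero_or_pos m with rfl | hm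
    · simp
    · obtain ⟨m, rfl⟩ : ∃ l, m = l + 1 := ⟨m - 1, by omega⟩
      rw [map_nsmul, map_sum]
      congr 1
      refine Finset.sum_congr rfl fun e _ => ?_
      have h2 : ∀ i, pairLaplacian α β (pderiv i ((pairLaplacian α β ^ m) f)) =
          pderiv i ((pairLaplacian α β ^ (m + 1)) f) := by
        intro i
        rw [pow_succ', Module.End.mul_apply]
        simpa using pairLaplacian_pow_pderiv α β 1 i ((pairLaplacian α β ^ m) f)
      rw [map_add, map_smul, map_smul, Nat.add_sub_cancel, h2, h2]

/-- Expectations under the linked covariance, expanded in powers of the correlation. -/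
theorem IsStein.eq_sum_pairLaplacian {r : ℝ} {α β : E → I} {L₀ : MvPolynomial I ℝ →ₗ[ℝ] ℝ}
    (h : IsStein (linkCov r α β) L) (h₀ : IsStein stdCov L₀) : ∀ N (f : MvPolynomial I ℝ),
    f.totalDegree ≤ N → ∀ D, N ≤ D → L f = ∑ m ∈ Finset.range (D + 1),
      (r ^ m * (m.factorial : ℝ)⁻¹) * L₀ ((pairLaplacian α β ^ m) f) := by
  refine totalDegree_induction ?_ ?_ ?_
  · intro N a D _
    rw [Finset.sum_range_succ', Finset.sum_eq_zero]
    · have : (MvPolynomial.C a : MvPolynomial I ℝ) = a • 1 := by rw [← C_mul', mul_one]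
      simp [this, h.one, h₀.one]
    · intro k _
      rw [pairLaplacian_pow_eq_zero _ _ _ (by simp), map_zero, mul_zero]
  · intro N f f' hf hf' D hD
    rw [map_add, hf D hD, hf' D hD, ← Finset.sum_add_distrib]
    simp [mul_add]
  · intro N j f hf ih D hD
    obtain ⟨D, rfl⟩ : ∃ l, D = l + 1 := ⟨D - 1, by omega⟩
    have h1 : ∀ m : ℕ, L₀ ((pairLaplacian α β ^ m) (X j * f)) =
        L₀ ((pairLaplacian α β ^ m) (pderiv j f)) +
        m * ∑ e, (stdCov (α e) j * L₀ ((pairLaplacian α β ^ (m - 1)) (pderiv (β e) f)) +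
          stdCov (β e) j * L₀ ((pairLaplacian α β ^ (m - 1)) (pderiv (α e) f))) := by
      intro m
      rw [pairLaplacian_pow_X_mul, map_add, h₀.X_mul, sum_stdCov_mul, map_nsmul, map_sum,
        nsmul_eq_mul, pairLaplacian_pow_pderiv]
      congr 2
      refine Finset.sum_congr rfl fun e _ => ?_
      rw [map_add, map_smul, map_smul, pairLaplacian_pow_pderiv, pairLaplacian_pow_pderiv]
      rfl
    -- Truncation at `D` instead of `D + 1`: these terms carry an extra factor `r`, which shifts the
    -- index by one.
    have h2 : ∀ i, L (pderiv i f) = ∑ m ∈ Finset.range (D + 1),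
        (r ^ m * (m.factorial : ℝ)⁻¹) * L₀ ((pairLaplacian α β ^ m) (pderiv i f)) := fun i =>
      ih _ (totalDegree_pderiv_le i f hf) D (by omega)
    rw [h.X_mul, sum_linkCov_mul, ih _ (totalDegree_pderiv_le j f hf) (D + 1) (by omega)]
    simp only [h1, mul_add, Finset.sum_add_distrib (s := Finset.range (D + 1 + 1))]
    congr 1
    rw [Finset.sum_range_succ']
    simp only [h2, Nat.cast_zero, zero_mul, mul_zero, add_zero, Nat.add_sub_cancel, Finset.mul_sum,
      ← Finset.sum_add_distrib, Finset.sum_const_zero]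
    rw [Finset.sum_comm]
    refine Finset.sum_congr rfl fun m _ => Finset.sum_congr rfl fun e _ => ?_
    rw [Nat.factorial_succ]
    have : ((m : ℝ) + 1) ≠ 0 := by positivity
    have : (m.factorial : ℝ) ≠ 0 := by positivity
    push_cast
    field_simp
    ring

end Algebra

/-! ### Averages over a family of links -/

section Average

variable {I E S : Type*} [Fintype I] [Fintype E] [DecidableEq I] [Fintype S]

/-- The average of a family of linear maps with weights `y`. -/
noncomputable def average {M N : Type*} [AddCommGroup M] [Module ℝ M] [AddCommGroup N] [Module ℝ N]
    (y : S → ℝ) (F : S → M →ₗ[ℝ] N) : M →ₗ[ℝ] N :=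
  (Fintype.card S : ℝ)⁻¹ • ∑ s, y s • F s

theorem average_apply {M N : Type*} [AddCommGroup M] [Module ℝ M] [AddCommGroup N] [Module ℝ N]
    (y : S → ℝ) (F : S → M →ₗ[ℝ] N) (x : M) :
    average y F x = (Fintype.card S : ℝ)⁻¹ • ∑ s, y s • F s x := by
  simp [average, LinearMap.sum_apply]

theorem sq_average_le (x : S → ℝ) :
    ((Fintype.card S : ℝ)⁻¹ * ∑ s, x s) ^ 2 ≤ (Fintype.card S : ℝ)⁻¹ * ∑ s, x s ^ 2 := by
  rcases isEmpty_or_nonempty S with hS | hS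
  · simp
  · have h : (0 : ℝ) < Fintype.card S := by exact_mod_cast Fintype.card_pos
    have h1 := sq_sum_le_card_mul_sum_sq (s := Finset.univ) (f := x)
    rw [Finset.card_univ] at h1
    rw [mul_pow, sq, mul_assoc]
    refine mul_le_mul_of_nonneg_left ?_ (by positivity)
    rw [inv_mul_le_iff₀ h]
    exact h1

/-- Jensen's inequality: the form is a sum of squares of expectations of iterated derivatives. -/
theorem chaosForm_average_le (F : S → MvPolynomial I ℝ →ₗ[ℝ] ℝ) (k : ℕ) (f : MvPolynomial I ℝ) :
    chaosForm stdCov (average (fun _ => 1) F) k f f ≤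
      (Fintype.card S : ℝ)⁻¹ * ∑ s, chaosForm stdCov (F s) k f f := by
  induction k generalizing f with
  | zero =>
    simpa [chaosForm_zero, average_apply, sq] using sq_average_le fun s => F s f
  | succ k ih =>
    simp only [chaosForm_stdCov_succ]
    rw [Finset.sum_comm, Finset.mul_sum]
    exact Finset.sum_le_sum fun i _ => ih _

/-- The form evaluates the functional only on derivatives of `f`, so an operator that commutes with
differentiation can be moved from the functional to the polynomial. -/
theorem chaosForm_stdCov_comp {L : MvPolynomial I ℝ →ₗ[ℝ] ℝ} {A : MvPolynomial I ℝ →ₗ[ℝ] ℝ}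
    {T : Module.End ℝ (MvPolynomial I ℝ)} {D : ℕ}
    (hT : ∀ i f, T (pderiv i f) = pderiv i (T f))
    (hA : ∀ f : MvPolynomial I ℝ, f.totalDegree ≤ D → A f = L (T f)) (k : ℕ)
    {f : MvPolynomial I ℝ} (hf : f.totalDegree ≤ D) :
    chaosForm stdCov A k f f = chaosForm stdCov L k (T f) (T f) := by
  induction k generalizing f with
  | zero => rw [chaosForm_zero, chaosForm_zero, hA f hf]
  | succ k ih =>
    rw [chaosForm_stdCov_succ, chaosForm_stdCov_succ]
    refine Finset.sum_congr rfl fun i _ => ?_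
    rw [ih (totalDegree_pderiv_le i f hf), hT]

/-- The operator that turns expectations under independence into weighted averages of
expectations under the links `α s e ~ β s e`. -/
noncomputable def linkOperator (r : ℝ) (y : S → ℝ) (α β : S → E → I) (D : ℕ) :
    Module.End ℝ (MvPolynomial I ℝ) :=
  ∑ m ∈ Finset.range (D + 1), (r ^ m * (m.factorial : ℝ)⁻¹) •
    average y fun s => pairLaplacian (α s) (β s) ^ m

theorem linkOperator_apply (r : ℝ) (y : S → ℝ) (α β : S → E → I) (D : ℕ) (f : MvPolynomial I ℝ) :
    linkOperator r y α β D f = ∑ m ∈ Finset.range (D + 1), (r ^ m * (m.factorial : ℝ)⁻¹) •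
      average y (fun s => pairLaplacian (α s) (β s) ^ m) f := by
  simp [linkOperator, LinearMap.sum_apply]

theorem linkOperator_pderiv (r : ℝ) (y : S → ℝ) (α β : S → E → I) (D : ℕ) (i : I)
    (f : MvPolynomial I ℝ) :
    linkOperator r y α β D (pderiv i f) = pderiv i (linkOperator r y α β D f) := by
  simp only [linkOperator_apply, average_apply, pairLaplacian_pow_pderiv, map_sum,
    Derivation.map_smul]

theorem totalDegree_linkOperator_le (r : ℝ) (y : S → ℝ) (α β : S → E → I) (D : ℕ)
    {f : MvPolynomial I ℝ} {N : ℕ} (hf : f.totalDegree ≤ N) :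
    (linkOperator r y α β D f).totalDegree ≤ N := by
  simp only [linkOperator_apply, average_apply]
  refine (totalDegree_finsetSum _ _).trans (Finset.sup_le fun m _ => ?_)
  refine (totalDegree_smul_le _ _).trans ((totalDegree_smul_le _ _).trans ?_)
  refine (totalDegree_finsetSum _ _).trans (Finset.sup_le fun s _ => ?_)
  exact (totalDegree_smul_le _ _).trans (totalDegree_pairLaplacian_pow_le _ _ _ hf)

variable {r : ℝ} {α β : S → E → I} {L₀ : MvPolynomial I ℝ →ₗ[ℝ] ℝ}
  {L : S → MvPolynomial I ℝ →ₗ[ℝ] ℝ}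

theorem average_eq_linkOperator (h₀ : IsStein stdCov L₀)
    (h : ∀ s, IsStein (linkCov r (α s) (β s)) (L s)) (y : S → ℝ) {D : ℕ} {f : MvPolynomial I ℝ}
    (hf : f.totalDegree ≤ D) : average y L f = L₀ (linkOperator r y α β D f) := by
  simp only [linkOperator_apply, average_apply, map_sum, map_smul, smul_eq_mul, Finset.mul_sum]
  rw [Finset.sum_comm]
  refine Finset.sum_congr rfl fun s _ => ?_
  rw [(h s).eq_sum_pairLaplacian h₀ D f hf D le_rfl, Finset.mul_sum, Finset.mul_sum]
  exact Finset.sum_congr rfl fun m _ => by ring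

/-- A lower bound for the average second moment, by the norm under independence. -/
theorem average_map_mul_self_ge (h₀ : IsStein stdCov L₀) (hr : 0 ≤ r) (hr' : r ≤ 1)
    (hαβ : ∀ s, Function.Injective (Sum.elim (α s) (β s)))
    (h : ∀ s, IsStein (linkCov r (α s) (β s)) (L s)) {D : ℕ} {f : MvPolynomial I ℝ}
    (hf : f.totalDegree ≤ D) :
    (1 - r) ^ D * L₀ (linkOperator r (fun _ => 1) α β D f * linkOperator r (fun _ => 1) α β D f) ≤
      (Fintype.card S : ℝ)⁻¹ * ∑ s, L s (f * f) := by
  have h1 := Finset.sum_le_sum fun s (_ : s ∈ Finset.univ) =>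
    (h s).map_mul_self_ge hr hr' (hαβ s) hf
  refine le_trans ?_ (mul_le_mul_of_nonneg_left h1 (by positivity))
  rw [← Finset.mul_sum, mul_left_comm]
  refine mul_le_mul_of_nonneg_left ?_ (pow_nonneg (by linarith) _)
  -- Parseval under independence, order by order: the chaos coefficients of `linkOperator` applied
  -- to `f` are those of `f` under the averaged functional, and Jensen compares these with the
  -- average over `s`.
  rw [h₀.map_mul D D _ (totalDegree_linkOperator_le _ _ _ _ _ hf) le_rfl, Finset.sum_comm,
    Finset.mul_sum]
  refine Finset.sum_le_sum fun k _ => ?_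
  rw [← Finset.mul_sum, mul_left_comm]
  refine mul_le_mul_of_nonneg_left ?_ (by positivity)
  rw [← chaosForm_stdCov_comp (linkOperator_pderiv r (fun _ => 1) α β D)
    (fun f hf => average_eq_linkOperator h₀ h (fun _ => 1) hf) k hf]
  exact chaosForm_average_le L k f

end Average

/-! ### Powers of contractions as sums over tuples of edges -/

section Tuples

variable {I E : Type*} [Fintype I] [Fintype E] [DecidableEq I]

/-- Iterated partial derivatives along a tuple of variables. -/
noncomputable def iterPderiv : (m : ℕ) → (Fin m → I) → Module.End ℝ (MvPolynomial I ℝ)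
  | 0, _ => 1
  | m + 1, s => iterPderiv m (Fin.tail s) * (pderiv (s 0)).toLinearMap

theorem iterPderiv_succ (m : ℕ) (s : Fin (m + 1) → I) (f : MvPolynomial I ℝ) :
    iterPderiv (m + 1) s f = iterPderiv m (Fin.tail s) (pderiv (s 0) f) := rfl

theorem iterPderiv_pderiv (m : ℕ) (s : Fin m → I) (i : I) (f : MvPolynomial I ℝ) :
    iterPderiv m s (pderiv i f) = pderiv i (iterPderiv m s f) := by
  induction m generalizing f with
  | zero => rfl
  | succ m ih => rw [iterPderiv_succ, iterPderiv_succ, pderiv_comm, ih]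

theorem totalDegree_iterPderiv_le (m : ℕ) (s : Fin m → I) {f : MvPolynomial I ℝ} {N : ℕ}
    (hf : f.totalDegree ≤ N) : (iterPderiv m s f).totalDegree ≤ N := by
  induction m generalizing f with
  | zero => exact hf
  | succ m ih => exact ih _ (totalDegree_pderiv_le _ _ hf)

theorem sum_tuple_succ {M : Type*} [AddCommMonoid M] (m : ℕ) (F : (Fin (m + 1) → E) → M) :
    ∑ s, F s = ∑ e, ∑ s : Fin m → E, F (Fin.cons e s) := by
  rw [← Fintype.sum_prod_type' (f := fun e s => F (Fin.cons e s))]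
  exact (Fintype.sum_equiv (Fin.consEquiv fun _ => E) _ _ fun _ => rfl).symm

theorem pairLaplacian_pow_eq_sum (α β : E → I) (m : ℕ) (f : MvPolynomial I ℝ) :
    (pairLaplacian α β ^ m) f =
      ∑ s : Fin m → E, iterPderiv m (α ∘ s) (iterPderiv m (β ∘ s) f) := by
  induction m generalizing f with
  | zero => simp [iterPderiv]
  | succ m ih =>
    rw [pow_succ, Module.End.mul_apply, pairLaplacian_apply, map_sum, sum_tuple_succ]
    refine Finset.sum_congr rfl fun e _ => ?_
    rw [ih]
    refine Finset.sum_congr rfl fun s _ => ?_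
    rw [iterPderiv_succ, iterPderiv_succ, iterPderiv_pderiv]
    rfl

variable {L : MvPolynomial I ℝ →ₗ[ℝ] ℝ}

theorem IsStein.sum_iterPderiv_le (h : IsStein stdCov L) {c : E → I} (hc : Function.Injective c)
    {D : ℕ} (m : ℕ) {f : MvPolynomial I ℝ} (hf : f.totalDegree ≤ D) :
    ∑ s : Fin m → E, L (iterPderiv m (c ∘ s) f * iterPderiv m (c ∘ s) f) ≤
      (D : ℝ) ^ m * L (f * f) := by
  induction m generalizing f with
  | zero => simp [iterPderiv]
  | succ m ih =>
    rw [sum_tuple_succ]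
    have h1 : ∑ e, L (pderiv (c e) f * pderiv (c e) f) ≤ D * L (f * f) := by
      refine le_trans ?_ (h.sum_pderiv_le hf)
      have h3 := Finset.sum_le_sum_of_subset_of_nonneg
        (Finset.subset_univ (Finset.univ.map ⟨c, hc⟩))
        (f := fun i => L (pderiv i f * pderiv i f)) (fun i _ _ => h.map_mul_self_nonneg _)
      rwa [Finset.sum_map] at h3
    rw [pow_succ, mul_assoc]
    refine le_trans ?_ (mul_le_mul_of_nonneg_left h1 (by positivity))
    rw [Finset.mul_sum]
    refine Finset.sum_le_sum fun e _ =>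
      le_trans (le_of_eq ?_) (ih (totalDegree_pderiv_le (c e) f hf))
    refine Finset.sum_congr rfl fun s _ => ?_
    rw [iterPderiv_succ]
    rfl

theorem IsStein.sum_sum_iterPderiv_le (h : IsStein stdCov L) {a b : E → I}
    (ha : Function.Injective a) (hb : Function.Injective b)
    {D : ℕ} (m : ℕ) {f : MvPolynomial I ℝ} (hf : f.totalDegree ≤ D) :
    ∑ s : Fin m → E, ∑ s' : Fin m → E, L (iterPderiv m (a ∘ s') (iterPderiv m (b ∘ s) f) *
      iterPderiv m (a ∘ s') (iterPderiv m (b ∘ s) f)) ≤ (D : ℝ) ^ (2 * m) * L (f * f) := by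
  rw [two_mul, pow_add, mul_assoc]
  refine le_trans ?_ (mul_le_mul_of_nonneg_left (h.sum_iterPderiv_le hb m hf) (by positivity))
  rw [Finset.mul_sum]
  exact Finset.sum_le_sum fun s _ => h.sum_iterPderiv_le ha m (totalDegree_iterPderiv_le m _ hf)

/-- A linear functional on polynomials is monotone for the pointwise order. -/
def IsMonotone (L : MvPolynomial I ℝ →ₗ[ℝ] ℝ) : Prop :=
  ∀ f : MvPolynomial I ℝ, (∀ x, 0 ≤ eval x f) → 0 ≤ L f

theorem IsMonotone.le (h : IsMonotone L) {f g : MvPolynomial I ℝ}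
    (hfg : ∀ x, eval x f ≤ eval x g) : L f ≤ L g := by
  rw [← sub_nonneg, ← map_sub]
  exact h _ fun x => by simpa using hfg x

/-- Pointwise Cauchy-Schwarz, transported by monotonicity. It separates the combinatorial
coefficients from the analytic norms. -/
theorem IsMonotone.map_sum_smul_sq_le (h : IsMonotone L) {ι : Type*} (s : Finset ι) (p : ι → ℝ)
    (f : ι → MvPolynomial I ℝ) :
    L ((∑ i ∈ s, p i • f i) * ∑ i ∈ s, p i • f i) ≤
      (∑ i ∈ s, p i ^ 2) * ∑ i ∈ s, L (f i * f i) := by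
  rw [← map_sum, ← smul_eq_mul (a := ∑ i ∈ s, p i ^ 2), ← map_smul]
  refine h.le fun x => ?_
  simp only [map_mul, map_sum, smul_eval]
  simp only [← sq]
  exact Finset.sum_mul_sq_le_sq_mul_sq s p fun i => eval x (f i)

/-- The mean square of a weighted average of powers of contractions is controlled by the
correlations of the weights with the events that one tuple is mapped to another. -/
theorem IsStein.average_pairLaplacian_le (h : IsStein stdCov L) (hL : IsMonotone L)
    [DecidableEq E] {S : Type*} [Fintype S] (y : S → ℝ) (σ : S → E → E) {a b : E → I}
    (ha : Function.Injective a) (hb : Function.Injective b) {D : ℕ} (m : ℕ)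
    {f : MvPolynomial I ℝ} (hf : f.totalDegree ≤ D) :
    L (average y (fun s => pairLaplacian (a ∘ σ s) b ^ m) f *
        average y (fun s => pairLaplacian (a ∘ σ s) b ^ m) f) ≤
      (∑ s : Fin m → E, ∑ s' : Fin m → E,
        ((Fintype.card S : ℝ)⁻¹ * ∑ t, y t * if σ t ∘ s = s' then 1 else 0) ^ 2) *
        ((D : ℝ) ^ (2 * m) * L (f * f)) := by
  have h1 : average y (fun s => pairLaplacian (a ∘ σ s) b ^ m) f =
      ∑ q : (Fin m → E) × (Fin m → E),
        ((Fintype.card S : ℝ)⁻¹ * ∑ t, y t * if σ t ∘ q.1 = q.2 then 1 else 0) •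
          iterPderiv m (a ∘ q.2) (iterPderiv m (b ∘ q.1) f) := by
    rw [average_apply, Fintype.sum_prod_type]
    simp only [pairLaplacian_pow_eq_sum, Finset.smul_sum, mul_smul, Finset.sum_smul]
    rw [Finset.sum_comm]
    refine Finset.sum_congr rfl fun s _ => ?_
    rw [Finset.sum_comm]
    refine Finset.sum_congr rfl fun t _ => ?_
    simp [ite_smul, Function.comp_assoc]
  rw [h1]
  refine (hL.map_sum_smul_sq_le _ _ _).trans ?_
  rw [Fintype.sum_prod_type, Fintype.sum_prod_type]
  exact mul_le_mul_of_nonneg_left (h.sum_sum_iterPderiv_le ha hb m hf)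
    (Finset.sum_nonneg fun _ _ => Finset.sum_nonneg fun _ _ => sq_nonneg _)

end Tuples

/-! ### Counting orbits of edge tuples by Burnside's lemma -/

section Orbits

theorem exists_perm_fixing_mapsTo {α : Type*} [Fintype α] [DecidableEq α] {u : α} {A W : Finset α}
    (huA : u ∈ A) (huW : u ∈ W) (h : A.card ≤ W.card) :
    ∃ g : Equiv.Perm α, g u = u ∧ ∀ x ∈ A, g x ∈ W := by
  obtain ⟨W', huW', hW', hcard⟩ := Finset.exists_subsuperset_card_eq
    (Finset.singleton_subset_iff.2 huW) (by simpa using Finset.card_pos.2 ⟨u, huA⟩) h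
  let e : {x // x ∈ A} ≃ {x // x ∈ W'} := Finset.equivOfCardEq hcard.symm
  have he : ∀ x ∈ A, e.extendSubtype x ∈ W' := fun x hx => e.extendSubtype_mem x hx
  -- The swap restores `u` as a fixed point. It exchanges two elements of `W'`, so the image of `A`
  -- stays inside `W'`.
  refine ⟨Equiv.swap (e.extendSubtype u) u * e.extendSubtype, by simp, fun x hx => hW' ?_⟩
  rw [Equiv.Perm.mul_apply, Equiv.swap_apply_def]
  split_ifs with h1 h2
  · exact huW' (Finset.mem_singleton_self u)
  · exact he u huA
  · exact he x hx

variable {n : ℕ}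

/-- Permutations of the nodes act on edges. -/
instance : MulAction (Equiv.Perm (Fin n)) (Edge n) where
  smul := permEdge
  one_smul e := Subtype.ext (by ext; simp [HSMul.hSMul, permEdge, Equiv.Perm.one_def])
  mul_smul g h e := Subtype.ext (by simp [HSMul.hSMul, permEdge, Finset.map_map]; rfl)

theorem card_orbits_edge_tuples_le (u : Fin n) (m : ℕ)
    [Fintype (Quotient (MulAction.orbitRel (MulAction.stabilizer (Equiv.Perm (Fin n)) u)
      (Fin m → Edge n)))] :
    Fintype.card (Quotient (MulAction.orbitRel (MulAction.stabilizer (Equiv.Perm (Fin n)) u)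
      (Fin m → Edge n))) ≤ ((2 * m + 1).choose 2) ^ m := by
  have hn : 1 ≤ n := by have := u.2; omega
  -- An `m`-tuple of edges together with `u` occupies at most `2m + 1` vertices, hence has a
  -- representative with all its edges inside one fixed set `W` containing `u`.
  obtain ⟨W, huW, -, hcard⟩ := Finset.exists_subsuperset_card_eq (n := min n (2 * m + 1))
    (Finset.subset_univ {u}) (by simp; omega) (by simp)
  rw [Finset.singleton_subset_iff] at huW
  let F : (Fin m → W.powersetCard 2) →
      Quotient (MulAction.orbitRel (MulAction.stabilizer (Equiv.Perm (Fin n)) u)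
        (Fin m → Edge n)) := fun s =>
    Quotient.mk _ fun i => ⟨(s i).1, (Finset.mem_powersetCard.1 (s i).2).2⟩
  have hF : Function.Surjective F := by
    intro q
    induction q using Quotient.inductionOn with
    | _ s =>
    let A : Finset (Fin n) := insert u (Finset.univ.biUnion fun i => (s i).1)
    have hA : A.card ≤ W.card := by
      rw [hcard, le_min_iff]
      refine ⟨by simpa using Finset.card_le_univ A, (Finset.card_insert_le _ _).trans ?_⟩
      refine Nat.succ_le_succ (Finset.card_biUnion_le.trans ?_)
      rw [Finset.sum_congr rfl fun i _ => (s i).2]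
      simp [mul_comm]
    obtain ⟨g, hgu, hg⟩ := exists_perm_fixing_mapsTo (Finset.mem_insert_self u _) huW hA
    have hsub : ∀ i, (permEdge g (s i)).1 ∈ W.powersetCard 2 := by
      intro i
      rw [Finset.mem_powersetCard]
      refine ⟨fun x hx => ?_, (permEdge g (s i)).2⟩
      obtain ⟨y, hy, rfl⟩ := Finset.mem_map.1 hx
      exact hg y (Finset.mem_insert_of_mem (Finset.mem_biUnion.2 ⟨i, Finset.mem_univ i, hy⟩))
    refine ⟨fun i => ⟨_, hsub i⟩, Quotient.sound ?_⟩
    exact ⟨⟨g, hgu⟩, rfl⟩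
  refine (Fintype.card_le_of_surjective F hF).trans ?_
  rw [Fintype.card_fun, Fintype.card_coe, Finset.card_powersetCard, hcard, Fintype.card_fin]
  exact Nat.pow_le_pow_left (Nat.choose_le_choose 2 (min_le_right _ _)) m

theorem card_mul_card_stabilizer (u : Fin n) :
    n * Fintype.card (MulAction.stabilizer (Equiv.Perm (Fin n)) u) = n.factorial := by
  classical
  have h := MulAction.card_orbit_mul_card_stabilizer_eq_card_group (Equiv.Perm (Fin n)) u
  rw [Fintype.card_perm, Fintype.card_fin] at h
  rw [← h]
  congr 1
  have : MulAction.orbit (Equiv.Perm (Fin n)) u = Set.univ :=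
    Set.eq_univ_of_forall fun w => ⟨Equiv.swap u w, by simp⟩
  simp [this]

theorem sum_perm_eq_sum_stabilizer (u v : Fin n) (σ : Equiv.Perm (Fin n)) (hσ : σ u = v)
    (F : Equiv.Perm (Fin n) → ℝ) :
    ∑ τ : Equiv.Perm (Fin n), (if τ u = v then F τ else 0) =
      ∑ g : MulAction.stabilizer (Equiv.Perm (Fin n)) u, F (σ * g) := by
  rw [← Equiv.sum_comp (Equiv.mulLeft σ), ← Finset.sum_filter]
  refine Finset.sum_subtype _ (fun g => ?_) _
  simp [← hσ, MulAction.mem_stabilizer_iff]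

/-- Burnside's lemma for tuples of edges, on a coset of the stabilizer of a node. -/
theorem sum_sq_card_tuple_le (u v : Fin n) (m : ℕ) :
    (n : ℝ) ^ 2 * ∑ s : Fin m → Edge n, ∑ s' : Fin m → Edge n,
      (∑ σ : Equiv.Perm (Fin n), (if σ u = v then (1 : ℝ) else 0) *
        if permEdge σ ∘ s = s' then 1 else 0) ^ 2 ≤
      (n.factorial : ℝ) ^ 2 * ((2 * m + 1).choose 2 : ℝ) ^ m := by
  classical
  set G := MulAction.stabilizer (Equiv.Perm (Fin n)) u with hG
  have hB := MulAction.sum_card_fixedBy_eq_card_orbits_mul_card_group G (Fin m → Edge n)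
  have hfix : ∀ g : G, (Fintype.card (MulAction.fixedBy (Fin m → Edge n) g) : ℝ) =
      ∑ s : Fin m → Edge n, if permEdge (g : Equiv.Perm (Fin n)) ∘ s = s then 1 else 0 := by
    intro g
    rw [Finset.sum_boole, Fintype.card_subtype]
    rfl
  have hcomp : ∀ (σ g : Equiv.Perm (Fin n)) (s : Fin m → Edge n),
      permEdge (σ * g) ∘ s = permEdge σ ∘ s ↔ permEdge g ∘ s = s := by
    intro σ g s
    constructor
    · intro h
      funext i
      have h1 := congrFun h i
      exact smul_left_cancel σ ((mul_smul σ g (s i)).symm.trans h1)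
    · intro h
      funext i
      have h1 := congrFun h i
      exact (mul_smul σ g (s i)).trans (congrArg (σ • ·) h1)
  -- Expanding the square and summing over `s'` counts the pairs `σ, τ` sending `u` to `v` with `σ s
  -- = τ s`. Writing `τ = σ g` with `g` in the stabilizer turns this condition into `g s = s`.
  have h1 : ∑ s : Fin m → Edge n, ∑ s' : Fin m → Edge n,
      (∑ σ : Equiv.Perm (Fin n), (if σ u = v then (1 : ℝ) else 0) *
        if permEdge σ ∘ s = s' then 1 else 0) ^ 2 =
      ∑ σ : Equiv.Perm (Fin n), if σ u = v then
        ∑ g : G, (Fintype.card (MulAction.fixedBy (Fin m → Edge n) g) : ℝ) else 0 := by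
    have h2 : ∀ s : Fin m → Edge n, ∑ s' : Fin m → Edge n,
        (∑ σ : Equiv.Perm (Fin n), (if σ u = v then (1 : ℝ) else 0) *
          if permEdge σ ∘ s = s' then 1 else 0) ^ 2 =
        ∑ σ : Equiv.Perm (Fin n), if σ u = v then
          ∑ g : G, (if permEdge (g : Equiv.Perm (Fin n)) ∘ s = s then (1 : ℝ) else 0) else 0 := by
      intro s
      simp only [sq, Finset.sum_mul_sum]
      rw [Finset.sum_comm]
      refine Finset.sum_congr rfl fun σ _ => ?_
      split_ifs with hσ
      · rw [Finset.sum_comm]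
        have h4 : ∑ g : G, (if permEdge (g : Equiv.Perm (Fin n)) ∘ s = s then (1 : ℝ) else 0) =
            ∑ g : G, if permEdge (σ * (g : Equiv.Perm (Fin n))) ∘ s = permEdge σ ∘ s then 1 else 0 :=
          Finset.sum_congr rfl fun g _ => if_congr (hcomp σ g s).symm rfl rfl
        rw [h4, ← sum_perm_eq_sum_stabilizer u v σ hσ
            (fun τ => if permEdge τ ∘ s = permEdge σ ∘ s then 1 else 0)]
        refine Finset.sum_congr rfl fun τ _ => ?_
        by_cases heq : permEdge τ ∘ s = permEdge σ ∘ s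
        · simp [heq]
        · simp [heq, Ne.symm heq]
      · simp
    rw [Finset.sum_congr rfl fun s _ => h2 s, Finset.sum_comm]
    refine Finset.sum_congr rfl fun σ _ => ?_
    split_ifs with hσ
    · simp only [hfix]
      rw [Finset.sum_comm]
    · simp
  have hv : ∑ σ : Equiv.Perm (Fin n), (if σ u = v then (1 : ℝ) else 0) = Fintype.card G := by
    rw [sum_perm_eq_sum_stabilizer u v (Equiv.swap u v) (by simp) fun _ => 1]
    simp [hG]
  have hN : (n : ℝ) * Fintype.card G = n.factorial := by
    exact_mod_cast card_mul_card_stabilizer u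
  have hBr : (∑ g : G, (Fintype.card (MulAction.fixedBy (Fin m → Edge n) g) : ℝ)) ≤
      ((2 * m + 1).choose 2 : ℝ) ^ m * Fintype.card G := by
    rw [← Nat.cast_sum, hB, Nat.cast_mul]
    refine mul_le_mul_of_nonneg_right ?_ (Nat.cast_nonneg _)
    exact_mod_cast card_orbits_edge_tuples_le u m
  rw [h1, ← hN]
  have h3 : ∀ (c : ℝ), ∑ σ : Equiv.Perm (Fin n), (if σ u = v then c else 0) =
      Fintype.card G * c := by
    intro c
    rw [← hv, Finset.sum_mul]
    exact Finset.sum_congr rfl fun σ _ => by split_ifs <;> simp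
  rw [h3]
  calc _ ≤ (n : ℝ) ^ 2 * (Fintype.card G *
        (((2 * m + 1).choose 2 : ℝ) ^ m * Fintype.card G)) := by gcongr
    _ = _ := by ring

/-- Splitting by the value `v` of `σ u` and Cauchy-Schwarz over the `n` values lose a factor `n²`,
which the factor `n²` in `sum_sq_card_tuple_le` compensates. -/
theorem sum_sq_card_tuple_le' (u : Fin n) (m : ℕ) :
    ∑ s : Fin m → Edge n, ∑ s' : Fin m → Edge n,
      (∑ σ : Equiv.Perm (Fin n), if permEdge σ ∘ s = s' then (1 : ℝ) else 0) ^ 2 ≤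
      (n.factorial : ℝ) ^ 2 * ((2 * m + 1).choose 2 : ℝ) ^ m := by
  have hn : (0 : ℝ) < n := by exact_mod_cast (Nat.zero_le _).trans_lt u.2
  have h1 : ∀ s s' : Fin m → Edge n,
      (∑ σ : Equiv.Perm (Fin n), if permEdge σ ∘ s = s' then (1 : ℝ) else 0) ^ 2 ≤
      n * ∑ v, (∑ σ : Equiv.Perm (Fin n), (if σ u = v then (1 : ℝ) else 0) *
        if permEdge σ ∘ s = s' then 1 else 0) ^ 2 := by
    intro s s'
    have h2 := sq_sum_le_card_mul_sum_sq (s := (Finset.univ : Finset (Fin n)))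
      (f := fun v => ∑ σ : Equiv.Perm (Fin n), (if σ u = v then (1 : ℝ) else 0) *
        if permEdge σ ∘ s = s' then 1 else 0)
    rw [Finset.card_univ, Fintype.card_fin, Finset.sum_comm] at h2
    simpa [← Finset.sum_mul] using h2
  refine (Finset.sum_le_sum fun s _ => Finset.sum_le_sum fun s' _ => h1 s s').trans ?_
  simp only [← Finset.mul_sum]
  simp only [Finset.sum_comm (s := (Finset.univ : Finset (Fin m → Edge n)))
    (t := (Finset.univ : Finset (Fin n)))]
  refine le_of_mul_le_mul_left ?_ hn
  rw [← mul_assoc, ← sq, Finset.mul_sum]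
  refine (Finset.sum_le_sum fun v _ => sum_sq_card_tuple_le u v m).trans ?_
  simp

theorem choose_pow_le {m D : ℕ} (h : 2 * m ≤ D) :
    ((2 * m + 1).choose 2 : ℝ) ^ m ≤ (D : ℝ) ^ (2 * m) := by
  rcases Nat.eq_zero_or_pos m with rfl | hm
  · simp
  · rw [pow_mul]
    refine pow_le_pow_left₀ (by positivity) ?_ m
    rw [Nat.choose_two_right, Nat.add_sub_cancel]
    have h1 : (2 * m + 1) * (2 * m) / 2 = (2 * m + 1) * m := by
      rw [mul_comm 2 m, ← mul_assoc, Nat.mul_div_cancel _ two_pos]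
    rw [h1]
    have h2 : (2 * m + 1) * m ≤ D ^ 2 := by nlinarith
    exact_mod_cast h2

/-- The correlations of the hidden permutation with events on `m`-tuples of edges. -/
theorem sum_sq_average_one_le (u : Fin n) {m D : ℕ} (h : 2 * m ≤ D) :
    ∑ s : Fin m → Edge n, ∑ s' : Fin m → Edge n,
      ((Fintype.card (Equiv.Perm (Fin n)) : ℝ)⁻¹ * ∑ σ : Equiv.Perm (Fin n),
        (1 : ℝ) * if permEdge σ ∘ s = s' then 1 else 0) ^ 2 ≤ (D : ℝ) ^ (2 * m) := by
  refine le_trans ?_ (choose_pow_le h)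
  simp only [mul_pow, ← Finset.mul_sum, one_mul, Fintype.card_perm, Fintype.card_fin]
  rw [inv_pow, inv_mul_le_iff₀ (by positivity)]
  exact sum_sq_card_tuple_le' u m

/-- Each coefficient is a difference of two nonnegative numbers, so its square is at most the sum of
their squares. Each of the two contributes `1/n²`: one by the size of a stabilizer coset, the other
by the factor `1/n` of the mean. -/
theorem sum_sq_average_indicator_le (u v : Fin n) {m D : ℕ} (h : 2 * m ≤ D) :
    ∑ s : Fin m → Edge n, ∑ s' : Fin m → Edge n,
      ((Fintype.card (Equiv.Perm (Fin n)) : ℝ)⁻¹ * ∑ σ : Equiv.Perm (Fin n),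
        ((if σ u = v then 1 else 0) - (n : ℝ)⁻¹) * if permEdge σ ∘ s = s' then 1 else 0) ^ 2 ≤
      2 / (n : ℝ) ^ 2 * (D : ℝ) ^ (2 * m) := by
  have hn : (0 : ℝ) < n := by exact_mod_cast (Nat.zero_le _).trans_lt u.2
  refine le_trans ?_ (mul_le_mul_of_nonneg_left (choose_pow_le h) (by positivity))
  simp only [mul_pow, ← Finset.mul_sum, Fintype.card_perm, Fintype.card_fin]
  rw [inv_pow, inv_mul_le_iff₀ (by positivity), div_mul_eq_mul_div, ← mul_div_assoc,
    le_div_iff₀ (by positivity)]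
  have h1 := sum_sq_card_tuple_le u v m
  have h2 := sum_sq_card_tuple_le' u m
  have h3 : ∀ s s' : Fin m → Edge n, (∑ σ : Equiv.Perm (Fin n),
      ((if σ u = v then 1 else 0) - (n : ℝ)⁻¹) * if permEdge σ ∘ s = s' then 1 else 0) ^ 2 ≤
      (∑ σ : Equiv.Perm (Fin n), (if σ u = v then (1 : ℝ) else 0) *
        if permEdge σ ∘ s = s' then 1 else 0) ^ 2 + ((n : ℝ) ^ 2)⁻¹ *
      (∑ σ : Equiv.Perm (Fin n), if permEdge σ ∘ s = s' then (1 : ℝ) else 0) ^ 2 := by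
    intro s s'
    simp only [sub_mul, Finset.sum_sub_distrib, ← Finset.mul_sum]
    have ha : 0 ≤ ∑ σ : Equiv.Perm (Fin n), (if σ u = v then (1 : ℝ) else 0) *
        if permEdge σ ∘ s = s' then 1 else 0 :=
      Finset.sum_nonneg fun σ _ => by positivity
    have hb : 0 ≤ (n : ℝ)⁻¹ * ∑ σ : Equiv.Perm (Fin n),
        if permEdge σ ∘ s = s' then (1 : ℝ) else 0 :=
      mul_nonneg (by positivity) (Finset.sum_nonneg fun σ _ => by positivity)
    rw [← inv_pow, ← mul_pow]
    nlinarith [mul_nonneg ha hb]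
  have h4 := Finset.sum_le_sum fun s (_ : s ∈ Finset.univ) =>
    Finset.sum_le_sum fun s' (_ : s' ∈ Finset.univ) => h3 s s'
  simp only [Finset.sum_add_distrib, ← Finset.mul_sum] at h4
  refine (mul_le_mul_of_nonneg_right h4 (by positivity)).trans ?_
  rw [add_mul, inv_mul_eq_div, div_mul_cancel₀ _ (by positivity)]
  linarith

end Orbits

/-! ### Gaussian moments and Stein's identity -/

section Moments

theorem integrable_pow_gaussianReal (k : ℕ) :
    Integrable (fun x : ℝ => x ^ k) (gaussianReal 0 1) := by
  have h := (memLp_id_gaussianReal (μ := 0) (v := 1) (k : NNReal)).integrable_norm_pow'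
  refine (integrable_norm_iff (by fun_prop)).1 ?_
  simpa using h

/-- Integration by parts: the derivative of the density is `-x` times the density. -/
theorem integral_pow_gaussianReal_succ (k : ℕ) :
    ∫ x, x ^ (k + 1) ∂(gaussianReal 0 1) = k * ∫ x, x ^ (k - 1) ∂(gaussianReal 0 1) := by
  have hint : ∀ k : ℕ, Integrable (fun x : ℝ => x ^ k * gaussianPDFReal 0 1 x) := by
    intro k
    have h := integrable_pow_gaussianReal k
    rw [gaussianReal_of_var_ne_zero _ one_ne_zero,
      integrable_withDensity_iff_integrable_smul' (measurable_gaussianPDF 0 1)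
        (Filter.Eventually.of_forall fun x => by simp [gaussianPDF])] at h
    refine h.congr (Filter.Eventually.of_forall fun x => ?_)
    simp [mul_comm]
  have hderiv : ∀ x : ℝ, HasDerivAt (gaussianPDFReal 0 1) (-x * gaussianPDFReal 0 1 x) x := by
    intro x
    have h1 : gaussianPDFReal 0 1 = fun x => (√(2 * Real.pi))⁻¹ * Real.exp (-x ^ 2 / 2) := by
      ext x
      simp [gaussianPDFReal]
    rw [h1]
    have h2 : HasDerivAt (fun x : ℝ => -x ^ 2 / 2) (-x) x := by
      refine HasDerivAt.congr_deriv (((hasDerivAt_pow 2 x).neg).div_const 2) ?_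
      norm_num
      ring
    refine ((h2.exp).const_mul ((√(2 * Real.pi))⁻¹)).congr_deriv ?_
    ring
  have hparts := integral_mul_deriv_eq_deriv_mul_of_integrable
    (u := fun x : ℝ => x ^ k) (v := gaussianPDFReal 0 1)
    (u' := fun x => k * x ^ (k - 1)) (v' := fun x => -x * gaussianPDFReal 0 1 x)
    (fun x _ => hasDerivAt_pow k x) (fun x _ => hderiv x)
    (by
      refine ((hint (k + 1)).neg).congr (Filter.Eventually.of_forall fun x => ?_)
      simp only [Pi.neg_apply, Pi.mul_apply]
      ring)
    (by
      refine ((hint (k - 1)).const_mul k).congr (Filter.Eventually.of_forall fun x => ?_)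
      simp only [Pi.mul_apply]
      ring)
    (hint k)
  rw [integral_gaussianReal_eq_integral_smul one_ne_zero,
    integral_gaussianReal_eq_integral_smul one_ne_zero, ← integral_const_mul]
  have h3 : ∀ x : ℝ, x ^ k * (-x * gaussianPDFReal 0 1 x) =
      -(gaussianPDFReal 0 1 x • x ^ (k + 1)) := fun x => by rw [smul_eq_mul]; ring
  simp only [h3, integral_neg, neg_inj] at hparts
  rw [hparts]
  congr 1
  ext x
  rw [smul_eq_mul]
  ring

/-- The random variables `ξ i` have the joint moments of independent standard Gaussians. -/
structure HasGaussianMoments {Ω I : Type*} [Fintype I] [MeasurableSpace Ω] (μ : Measure Ω)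
    (ξ : Ω → I → ℝ) : Prop where
  integrable : ∀ s : I → ℕ, Integrable (fun ω => ∏ i, ξ ω i ^ s i) μ
  integral : ∀ s : I → ℕ, ∫ ω, ∏ i, ξ ω i ^ s i ∂μ = ∏ i, ∫ x, x ^ s i ∂(gaussianReal 0 1)

variable {Ω I : Type*} [Fintype I] [MeasurableSpace Ω] {μ : Measure Ω} {ξ : Ω → I → ℝ}

theorem HasGaussianMoments.integrable_eval (h : HasGaussianMoments μ ξ) (f : MvPolynomial I ℝ) :
    Integrable (fun ω => eval (ξ ω) f) μ := by
  simp only [eval_eq']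
  exact integrable_finsetSum _ fun s _ => (h.integrable s).const_mul _

/-- The expectation of a polynomial in the variables `ξ i`. -/
noncomputable def HasGaussianMoments.expectation (h : HasGaussianMoments μ ξ) :
    MvPolynomial I ℝ →ₗ[ℝ] ℝ where
  toFun f := ∫ ω, eval (ξ ω) f ∂μ
  map_add' f g := by
    simp only [map_add]
    exact integral_add (h.integrable_eval f) (h.integrable_eval g)
  map_smul' c f := by
    simp only [smul_eval, integral_const_mul, RingHom.id_apply, smul_eq_mul]

theorem HasGaussianMoments.expectation_apply (h : HasGaussianMoments μ ξ)
    (f : MvPolynomial I ℝ) : h.expectation f = ∫ ω, eval (ξ ω) f ∂μ := rfl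

theorem HasGaussianMoments.expectation_monomial (h : HasGaussianMoments μ ξ) (s : I →₀ ℕ) (a : ℝ) :
    h.expectation (monomial s a) = a * ∏ i, ∫ x, x ^ s i ∂(gaussianReal 0 1) := by
  rw [h.expectation_apply, ← h.integral, ← integral_const_mul]
  congr 1
  ext ω
  rw [eval_monomial, Finsupp.prod_fintype _ _ (fun _ => pow_zero _)]

theorem HasGaussianMoments.isMonotone (h : HasGaussianMoments μ ξ) : IsMonotone h.expectation :=
  fun _ hf => integral_nonneg fun ω => hf (ξ ω)

theorem HasGaussianMoments.isStein [DecidableEq I] [IsProbabilityMeasure μ]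
    (h : HasGaussianMoments μ ξ) : IsStein stdCov h.expectation where
  one := by simp [h.expectation_apply]
  X_mul j f := by
    rw [sum_stdCov_mul]
    induction f using MvPolynomial.induction_on' with
    | add f g hf hg => rw [mul_add, map_add, map_add, map_add, hf, hg]
    | monomial s a =>
      rw [X, monomial_mul, one_mul, pderiv_monomial, h.expectation_monomial,
        h.expectation_monomial, ← Finset.mul_prod_erase _ _ (Finset.mem_univ j),
        ← Finset.mul_prod_erase _ _ (Finset.mem_univ j), mul_assoc]
      congr 1
      rw [← mul_assoc]
      congr 1
      · simp only [Finsupp.add_apply, Finsupp.single_eq_same, Finsupp.tsub_apply]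
        rw [add_comm, integral_pow_gaussianReal_succ]
      · refine Finset.prod_congr rfl fun i hi => ?_
        have hij : i ≠ j := Finset.ne_of_mem_erase hi
        simp [hij.symm]

end Moments

/-! ### Signal and noise as one Gaussian family -/

section Weights

variable {n p : ℕ}

/-- The law of the signal and noise weights. -/
noncomputable def weightLaw (n p : ℕ) : Measure ((Edge n → ℝ) × (Fin p → Edge n → ℝ)) :=
  (Measure.pi fun _ : Edge n => gaussianReal 0 1).prod
    (Measure.pi fun _ : Fin p => Measure.pi fun _ : Edge n => gaussianReal 0 1)

instance : IsProbabilityMeasure (weightLaw n p) := by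
  unfold weightLaw
  infer_instance

/-- Signal and noise weights as a single family of variables. -/
def weights (x : (Edge n → ℝ) × (Fin p → Edge n → ℝ)) : Edge n ⊕ Fin p × Edge n → ℝ :=
  Sum.elim x.1 fun q => x.2 q.1 q.2

theorem hasGaussianMoments_weights : HasGaussianMoments (weightLaw n p) weights where
  integrable s := by
    have h1 : Integrable (fun y : Edge n → ℝ => ∏ e, y e ^ s (Sum.inl e))
        (Measure.pi fun _ : Edge n => gaussianReal 0 1) :=
      Integrable.fintype_prod fun e => integrable_pow_gaussianReal _
    have h2 : Integrable (fun z : Fin p → Edge n → ℝ => ∏ k, ∏ e, z k e ^ s (Sum.inr (k, e)))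
        (Measure.pi fun _ : Fin p => Measure.pi fun _ : Edge n => gaussianReal 0 1) :=
      Integrable.fintype_prod (f := fun k (y : Edge n → ℝ) => ∏ e, y e ^ s (Sum.inr (k, e)))
        fun k => Integrable.fintype_prod fun e => integrable_pow_gaussianReal _
    refine (h1.mul_prod h2).congr (Filter.Eventually.of_forall fun x => ?_)
    simp [weights, Fintype.prod_sum_type, Fintype.prod_prod_type]
  integral s := by
    simp only [weights, Fintype.prod_sum_type, Fintype.prod_prod_type, Sum.elim_inl, Sum.elim_inr]
    unfold weightLaw
    rw [integral_prod_mul (fun y : Edge n → ℝ => ∏ e, y e ^ s (Sum.inl e))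
      (fun z : Fin p → Edge n → ℝ => ∏ k, ∏ e, z k e ^ s (Sum.inr (k, e))),
      integral_fintype_prod_eq_prod (fun e (x : ℝ) => x ^ s (Sum.inl e)),
      integral_fintype_prod_eq_prod
        (fun k (y : Edge n → ℝ) => ∏ e, y e ^ s (Sum.inr (k, e)))]
    congr 1
    refine Finset.prod_congr rfl fun k _ => ?_
    rw [integral_fintype_prod_eq_prod (fun e (x : ℝ) => x ^ s (Sum.inr (k, e)))]

end Weights

/-! ### The lower bound for a single hidden permutation -/

section Bounds

variable {n : ℕ} {I : Type*} [Fintype I] [DecidableEq I]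

theorem sum_pow_succ_le {x : ℝ} (h0 : 0 ≤ x) (h1 : x < 1) (D : ℕ) :
    ∑ m ∈ Finset.range D, x ^ (m + 1) ≤ x / (1 - x) := by
  rw [le_div_iff₀ (by linarith)]
  simp only [pow_succ']
  rw [← Finset.mul_sum, mul_assoc]
  refine mul_le_of_le_one_right h0 ?_
  rw [mul_comm, mul_neg_geom_sum]
  linarith [pow_nonneg h0 D]

/-- The part of `linkOperator` of positive order in the correlation. -/
noncomputable def linkRemainder (r : ℝ) (y : Equiv.Perm (Fin n) → ℝ) (a b : Edge n → I) (D : ℕ)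
    (f : MvPolynomial I ℝ) : MvPolynomial I ℝ :=
  ∑ m ∈ Finset.range D, (r ^ (m + 1) * ((m + 1).factorial : ℝ)⁻¹) •
    average y (fun σ => pairLaplacian (a ∘ permEdge σ) b ^ (m + 1)) f

theorem linkOperator_eq_add_linkRemainder (r : ℝ) (y : Equiv.Perm (Fin n) → ℝ) (a b : Edge n → I)
    (D : ℕ) (f : MvPolynomial I ℝ) :
    linkOperator r y (fun σ => a ∘ permEdge σ) (fun _ => b) D f =
      ((Fintype.card (Equiv.Perm (Fin n)) : ℝ)⁻¹ * ∑ σ, y σ) • f + linkRemainder r y a b D f := by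
  rw [linkOperator_apply, Finset.sum_range_succ', add_comm]
  congr 1
  simp [average_apply, ← Finset.sum_smul, mul_smul]

variable {L₀ : MvPolynomial I ℝ →ₗ[ℝ] ℝ}

/-- A contraction lowers the degree by two, so only orders with `2 * m ≤ D` survive and the
smallness of `r` is needed only for `D ≥ 2`. The coefficients and the derivatives each contribute `D
^ (2 * m)`, so the mean square of order `m` is at most `(r * D ^ 2) ^ (2 * m)` times `P * L₀ (f *
f)`. -/
theorem linkRemainder_sq_le (h : IsStein stdCov L₀) (hL : IsMonotone L₀) {a b : Edge n → I}
    (ha : Function.Injective a) (hb : Function.Injective b) {D : ℕ} {f : MvPolynomial I ℝ}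
    (hf : f.totalDegree ≤ D) {r t P : ℝ} (hr : 0 ≤ r) (ht0 : 0 ≤ t) (ht1 : t ≤ 1) (hP : 0 ≤ P)
    (hrt : 2 ≤ D → r * (D : ℝ) ^ 2 ≤ t / 5) (y : Equiv.Perm (Fin n) → ℝ)
    (hy : ∀ m, 2 * m ≤ D → ∑ s : Fin m → Edge n, ∑ s' : Fin m → Edge n,
      ((Fintype.card (Equiv.Perm (Fin n)) : ℝ)⁻¹ * ∑ σ, y σ *
        if permEdge σ ∘ s = s' then 1 else 0) ^ 2 ≤ P * (D : ℝ) ^ (2 * m)) :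
    L₀ (linkRemainder r y a b D f * linkRemainder r y a b D f) ≤
      P * (t ^ 2 / 15) * L₀ (f * f) := by
  set M := L₀ (f * f) with hM
  have hM0 : 0 ≤ M := h.map_mul_self_nonneg f
  let h_ : ℕ → MvPolynomial I ℝ := fun m =>
    average y (fun σ => pairLaplacian (a ∘ permEdge σ) b ^ m) f
  have hterm : ∀ m : ℕ, (r ^ (m + 1) * ((m + 1).factorial : ℝ)⁻¹) ^ 2 *
      L₀ (h_ (m + 1) * h_ (m + 1)) ≤ P * M * t ^ 2 * (1 / 25) ^ (m + 1) := by
    intro m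
    by_cases hm : 2 * (m + 1) ≤ D
    · have h1 : L₀ (h_ (m + 1) * h_ (m + 1)) ≤
          P * (D : ℝ) ^ (2 * (m + 1)) * ((D : ℝ) ^ (2 * (m + 1)) * M) :=
        (h.average_pairLaplacian_le hL y (fun σ => permEdge σ) ha hb (m + 1) hf).trans
          (mul_le_mul_of_nonneg_right (hy _ hm) (by positivity))
      have h2 : (r ^ (m + 1) * ((m + 1).factorial : ℝ)⁻¹) ^ 2 ≤ (r ^ (m + 1)) ^ 2 := by
        refine pow_le_pow_left₀ (by positivity) (mul_le_of_le_one_right (by positivity) ?_) 2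
        exact inv_le_one_of_one_le₀ (by exact_mod_cast Nat.succ_le_of_lt (Nat.factorial_pos _))
      have h3 : (r * (D : ℝ) ^ 2) ^ (2 * (m + 1)) ≤ t ^ 2 * (1 / 25) ^ (m + 1) := by
        refine (pow_le_pow_left₀ (by positivity) (hrt (by omega)) _).trans ?_
        rw [pow_mul, div_pow, div_pow, one_div, inv_pow, ← pow_mul, div_eq_mul_inv]
        refine mul_le_mul ?_ (by norm_num) (by positivity) (by positivity)
        exact pow_le_pow_of_le_one ht0 ht1 (by omega)
      calc _ ≤ (r ^ (m + 1)) ^ 2 * (P * (D : ℝ) ^ (2 * (m + 1)) * ((D : ℝ) ^ (2 * (m + 1)) * M)) :=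
            mul_le_mul h2 h1 (h.map_mul_self_nonneg _) (by positivity)
        _ = P * M * (r * (D : ℝ) ^ 2) ^ (2 * (m + 1)) := by ring
        _ ≤ P * M * (t ^ 2 * (1 / 25) ^ (m + 1)) := by gcongr
        _ = _ := by ring
    · have h1 : h_ (m + 1) = 0 := by
        simp only [h_, average_apply]
        rw [Finset.sum_eq_zero, smul_zero]
        intro σ _
        rw [pairLaplacian_pow_eq_zero _ _ _ (by omega), smul_zero]
      rw [h1, zero_mul, map_zero, mul_zero]
      positivity
  -- Cauchy-Schwarz with geometric weights `2^(-m)`: the two series give `1/3` and `4/21`, and `4/63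
  -- ≤ 1/15`.
  have hsum : linkRemainder r y a b D f = ∑ m ∈ Finset.range D, ((1 / 2 : ℝ) ^ (m + 1)) •
      ((2 : ℝ) ^ (m + 1) * (r ^ (m + 1) * ((m + 1).factorial : ℝ)⁻¹)) • h_ (m + 1) := by
    refine Finset.sum_congr rfl fun m _ => ?_
    rw [smul_smul, ← mul_assoc, ← mul_pow]
    norm_num [h_]
  rw [hsum]
  refine (hL.map_sum_smul_sq_le _ _ _).trans ?_
  have h4 : ∑ m ∈ Finset.range D, ((1 / 2 : ℝ) ^ (m + 1)) ^ 2 ≤ 1 / 3 := by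
    have := sum_pow_succ_le (x := 1 / 4) (by norm_num) (by norm_num) D
    refine le_trans (le_of_eq ?_) (this.trans (by norm_num))
    refine Finset.sum_congr rfl fun m _ => ?_
    rw [← pow_mul, mul_comm, pow_mul]
    norm_num
  have h5 : ∑ m ∈ Finset.range D, L₀
      ((((2 : ℝ) ^ (m + 1) * (r ^ (m + 1) * ((m + 1).factorial : ℝ)⁻¹)) • h_ (m + 1)) *
        (((2 : ℝ) ^ (m + 1) * (r ^ (m + 1) * ((m + 1).factorial : ℝ)⁻¹)) • h_ (m + 1))) ≤
      P * M * t ^ 2 * (4 / 21) := by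
    have := sum_pow_succ_le (x := 4 / 25) (by norm_num) (by norm_num) D
    have h6 : ∑ m ∈ Finset.range D, P * M * t ^ 2 * (4 / 25 : ℝ) ^ (m + 1) ≤
        P * M * t ^ 2 * (4 / 21) := by
      rw [← Finset.mul_sum]
      exact mul_le_mul_of_nonneg_left (this.trans (by norm_num)) (by positivity)
    refine le_trans (Finset.sum_le_sum fun m _ => ?_) h6
    rw [smul_mul_smul_comm, map_smul, smul_eq_mul]
    calc _ = (4 : ℝ) ^ (m + 1) * ((r ^ (m + 1) * ((m + 1).factorial : ℝ)⁻¹) ^ 2 *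
            L₀ (h_ (m + 1) * h_ (m + 1))) := by
          rw [show (4 : ℝ) = 2 ^ 2 by norm_num, ← pow_mul, mul_comm 2 (m + 1), pow_mul]
          ring
      _ ≤ (4 : ℝ) ^ (m + 1) * (P * M * t ^ 2 * (1 / 25) ^ (m + 1)) :=
          mul_le_mul_of_nonneg_left (hterm m) (by positivity)
      _ = P * M * t ^ 2 * (4 / 25) ^ (m + 1) := by
          rw [show (4 / 25 : ℝ) = 4 * (1 / 25) by norm_num, mul_pow]
          ring
  refine (mul_le_mul h4 h5 (Finset.sum_nonneg fun m _ => h.map_mul_self_nonneg _)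
    (by norm_num)).trans ?_
  have : 0 ≤ P * M * t ^ 2 := by positivity
  nlinarith

theorem average_indicator (u v : Fin n) :
    (Fintype.card (Equiv.Perm (Fin n)) : ℝ)⁻¹ *
      ∑ σ : Equiv.Perm (Fin n), (if σ u = v then (1 : ℝ) else 0) = (n : ℝ)⁻¹ := by
  have hn : (0 : ℝ) < n := by exact_mod_cast (Nat.zero_le _).trans_lt u.2
  have hv : ∑ σ : Equiv.Perm (Fin n), (if σ u = v then (1 : ℝ) else 0) =
      Fintype.card (MulAction.stabilizer (Equiv.Perm (Fin n)) u) := by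
    rw [sum_perm_eq_sum_stabilizer u v (Equiv.swap u v) (by simp) fun _ => 1]
    simp
  have hN : (n : ℝ) * Fintype.card (MulAction.stabilizer (Equiv.Perm (Fin n)) u) =
      n.factorial := by
    exact_mod_cast card_mul_card_stabilizer u
  have hf : (n.factorial : ℝ) ≠ 0 := by positivity
  rw [hv, Fintype.card_perm, Fintype.card_fin, inv_mul_eq_div, div_eq_iff hf, ← hN]
  field_simp

/-- Low-degree polynomials do not predict the position of a node under the hidden permutation. -/
theorem average_sq_error_ge (h₀ : IsStein stdCov L₀) (hL : IsMonotone L₀) {a b : Edge n → I}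
    (hab : Function.Injective (Sum.elim a b)) {L : Equiv.Perm (Fin n) → MvPolynomial I ℝ →ₗ[ℝ] ℝ}
    {r : ℝ} (h : ∀ σ, IsStein (linkCov r (a ∘ permEdge σ) b) (L σ)) {D : ℕ}
    {f : MvPolynomial I ℝ} (hf : f.totalDegree ≤ D) {t : ℝ} (hr : 0 ≤ r) (hr1 : r ≤ 1)
    (ht0 : 0 ≤ t) (ht1 : t ≤ 1) (hrt : 2 ≤ D → r * (D : ℝ) ^ 2 ≤ t / 5) (hrD : D * r ≤ 1 / 2)
    (u v : Fin n) :
    1 / (n : ℝ) - 1 / (n : ℝ) ^ 2 - t ^ 2 / (n : ℝ) ^ 2 ≤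
      (Fintype.card (Equiv.Perm (Fin n)) : ℝ)⁻¹ * ∑ σ : Equiv.Perm (Fin n),
        L σ ((f - MvPolynomial.C (if σ u = v then 1 else 0)) *
          (f - MvPolynomial.C (if σ u = v then 1 else 0))) := by
  have hn : (0 : ℝ) < n := by exact_mod_cast (Nat.zero_le _).trans_lt u.2
  have ha : Function.Injective a := hab.comp Sum.inl_injective
  have hb : Function.Injective b := hab.comp Sum.inr_injective
  have hperm : ∀ σ : Equiv.Perm (Fin n), Function.Injective (permEdge σ) := fun σ =>
    MulAction.injective σ
  have hαβ : ∀ σ : Equiv.Perm (Fin n), Function.Injective (Sum.elim (a ∘ permEdge σ) b) := by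
    intro σ
    have : Sum.elim (a ∘ permEdge σ) b = Sum.elim a b ∘ Sum.map (permEdge σ) id := by
      rw [Sum.elim_comp_map, Function.comp_id]
    rw [this]
    exact hab.comp (Sum.map_injective.2 ⟨hperm σ, Function.injective_id⟩)
  have hN : (Fintype.card (Equiv.Perm (Fin n)) : ℝ) ≠ 0 := by
    exact_mod_cast Fintype.card_ne_zero
  set N : ℝ := (Fintype.card (Equiv.Perm (Fin n)) : ℝ) with hN'
  let y : Equiv.Perm (Fin n) → ℝ := fun σ => (if σ u = v then 1 else 0) - (n : ℝ)⁻¹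
  have hind := average_indicator u v
  rw [← hN'] at hind
  have hysum : N⁻¹ * ∑ σ, y σ = 0 := by
    simp only [y, Finset.sum_sub_distrib, mul_sub, hind]
    simp only [Finset.sum_const, Finset.card_univ, nsmul_eq_mul, ← hN']
    rw [inv_mul_cancel_left₀ hN, sub_self]
  have hysq : N⁻¹ * ∑ σ, y σ ^ 2 = 1 / (n : ℝ) - 1 / (n : ℝ) ^ 2 := by
    have h1 : ∀ σ, y σ ^ 2 = (1 - 2 * (n : ℝ)⁻¹) * (if σ u = v then (1 : ℝ) else 0) +
        ((n : ℝ)⁻¹) ^ 2 := by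
      intro σ
      simp only [y]
      split_ifs <;> ring
    simp only [h1, Finset.sum_add_distrib, ← Finset.mul_sum, mul_add]
    rw [mul_left_comm, hind]
    simp only [Finset.sum_const, Finset.card_univ, nsmul_eq_mul, ← hN']
    rw [inv_mul_cancel_left₀ hN]
    field_simp
    ring
  -- Centring `f` together with the indicator makes the order zero term of `B` vanish.
  set g := f - MvPolynomial.C (n : ℝ)⁻¹ with hg
  have hgD : g.totalDegree ≤ D := (totalDegree_sub_C_le _ _).trans hf
  have hC : ∀ c : ℝ, (MvPolynomial.C c : MvPolynomial I ℝ) = c • 1 := fun c => by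
    rw [← C_mul', mul_one]
  have hexp : ∀ σ : Equiv.Perm (Fin n), L σ ((f - MvPolynomial.C (if σ u = v then 1 else 0)) *
      (f - MvPolynomial.C (if σ u = v then 1 else 0))) =
      L σ (g * g) - 2 * (y σ * L σ g) + y σ ^ 2 := by
    intro σ
    have h1 : f - MvPolynomial.C (if σ u = v then 1 else 0) = g - y σ • 1 := by
      rw [← hC, hg, sub_sub, ← C_add]
      simp [y]
    rw [h1]
    have h2 : (g - y σ • 1) * (g - y σ • 1) = g * g - (2 * y σ) • g + (y σ ^ 2) • 1 := by
      simp only [Algebra.smul_def, map_mul, map_pow, map_ofNat]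
      ring
    rw [h2, map_add, map_sub, map_smul, map_smul, (h σ).one]
    simp only [smul_eq_mul]
    ring
  set A := N⁻¹ * ∑ σ, L σ (g * g) with hA
  set B := N⁻¹ * ∑ σ, y σ * L σ g with hB
  set M := L₀ (g * g) with hM
  have hM0 : 0 ≤ M := h₀.map_mul_self_nonneg g
  have htotal : N⁻¹ * ∑ σ : Equiv.Perm (Fin n),
      L σ ((f - MvPolynomial.C (if σ u = v then 1 else 0)) *
        (f - MvPolynomial.C (if σ u = v then 1 else 0))) =
      A - 2 * B + (1 / (n : ℝ) - 1 / (n : ℝ) ^ 2) := by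
    rw [← hysq, hA, hB]
    simp only [hexp, Finset.sum_add_distrib, Finset.sum_sub_distrib, ← Finset.mul_sum]
    ring
  -- The operator with weights `1` is the identity plus `R`, with `L₀ (R²) ≤ M / 15`. Hence `L₀ ((g
  -- + R)²) ≥ (1 - 2/15) M / 2 = 13/30 M`, and Bernoulli's inequality gives `(1 - r)^D ≥ 1/2`.
  have hAM : 13 / 60 * M ≤ A := by
    have h1 := average_map_mul_self_ge h₀ hr hr1 hαβ h hgD
    rw [← hN', ← hA, linkOperator_eq_add_linkRemainder] at h1
    have h2 := linkRemainder_sq_le h₀ hL ha hb hgD hr ht0 ht1 zero_le_one hrt (fun _ => 1)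
      (fun m hm => by simpa only [one_mul] using sum_sq_average_one_le u hm)
    rw [← hM] at h2
    have h3 : (N⁻¹ * ∑ _σ : Equiv.Perm (Fin n), (1 : ℝ)) = 1 := by
      simp only [Finset.sum_const, Finset.card_univ, nsmul_eq_mul, ← hN', mul_one]
      exact inv_mul_cancel₀ hN
    rw [h3, one_smul] at h1
    set R := linkRemainder r (fun _ => 1) a b D g
    have h4 : M ≤ 2 * L₀ ((g + R) * (g + R)) + 2 * L₀ (R * R) := by
      have h5 : L₀ (g * g) ≤ L₀ ((2 : ℝ) • ((g + R) * (g + R)) + (2 : ℝ) • (R * R)) := by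
        refine hL.le fun x => ?_
        simp only [map_add, map_mul, smul_eval]
        nlinarith [sq_nonneg (eval x g + 2 * eval x R)]
      rwa [map_add, map_smul, map_smul] at h5
    have h5 : (1 : ℝ) / 2 ≤ (1 - r) ^ D := by
      have := one_add_mul_le_pow (a := -r) (by linarith) D
      rw [← sub_eq_add_neg] at this
      linarith
    have h6 : t ^ 2 ≤ 1 := pow_le_one₀ ht0 ht1
    have h7 : 13 / 30 * M ≤ L₀ ((g + R) * (g + R)) := by nlinarith
    have h8 := mul_le_mul h5 h7 (by positivity) (by positivity)
    linarith
  -- The weights `y` have mean zero, so `B` is `L₀` of a remainder alone, and its square is at most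
  -- the second moment.
  have hBM : B ^ 2 ≤ 2 / (n : ℝ) ^ 2 * (t ^ 2 / 15) * M := by
    have h1 : B = L₀ (linkRemainder r y a b D g) := by
      have h2 := average_eq_linkOperator h₀ h y hgD
      rw [linkOperator_eq_add_linkRemainder, ← hN', hysum, zero_smul, zero_add] at h2
      rw [← h2, average_apply]
      rfl
    refine le_trans ?_ (linkRemainder_sq_le h₀ hL ha hb hgD hr ht0 ht1 (by positivity) hrt y
      fun m hm => sum_sq_average_indicator_le u v hm)
    set R := linkRemainder r y a b D g
    have h3 := h₀.map_mul_self_nonneg (R - L₀ R • 1)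
    have h4 : (R - L₀ R • 1) * (R - L₀ R • 1) = R * R - (2 * L₀ R) • R + (L₀ R ^ 2) • 1 := by
      simp only [Algebra.smul_def, map_mul, map_pow, map_ofNat]
      ring
    rw [h4, map_add, map_sub, map_smul, map_smul, h₀.one, smul_eq_mul, smul_eq_mul] at h3
    rw [h1]
    linarith
  rw [htotal]
  set s := t ^ 2 / (n : ℝ) ^ 2 with hs
  have hs0 : 0 ≤ s := by positivity
  have hB' : B ^ 2 ≤ 2 / 15 * (s * M) := by
    refine hBM.trans (le_of_eq ?_)
    rw [hs]
    ring
  -- By the inequality of means, the square of the right side is at least `52/60 * s * M`, which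
  -- exceeds `4 B² ≤ 32/60 * s * M`.
  have h9 : 2 * B ≤ 13 / 60 * M + s := by
    refine le_of_sq_le_sq ?_ (by positivity)
    nlinarith [sq_nonneg (13 / 60 * M - s), mul_nonneg hs0 hM0]
  linarith

end Bounds

/-! ### Linear changes of Gaussian variables -/

section Substitution

theorem totalDegree_aeval_le {I J : Type*} (v : J → MvPolynomial I ℝ)
    (hv : ∀ j, (v j).totalDegree ≤ 1) (f : MvPolynomial J ℝ) :
    (aeval v f).totalDegree ≤ f.totalDegree := by
  have key : ∀ N (f : MvPolynomial J ℝ), f.totalDegree ≤ N → (aeval v f).totalDegree ≤ N := by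
    refine totalDegree_induction ?_ ?_ ?_
    · intro N a
      simp
    · intro N f g hf hg
      rw [map_add]
      exact (totalDegree_add _ _).trans (max_le hf hg)
    · intro N j f hf ih
      rw [map_mul, aeval_X]
      refine (totalDegree_mul _ _).trans ?_
      have := ih f hf
      have := hv j
      omega
  exact key _ f le_rfl

variable {I J : Type*} [Fintype I] [DecidableEq I] [Fintype J] [DecidableEq J]

theorem pderiv_aeval_linear (v : J → MvPolynomial I ℝ) (c : I → J → ℝ)
    (hv : ∀ i j, pderiv i (v j) = MvPolynomial.C (c i j)) (i : I) (f : MvPolynomial J ℝ) :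
    pderiv i (aeval v f) = ∑ j, c i j • aeval v (pderiv j f) := by
  induction f using MvPolynomial.induction_on with
  | C a => simp
  | add f g hf hg => simp only [map_add, hf, hg, smul_add, Finset.sum_add_distrib]
  | mul_X f k hf =>
    have h1 : ∀ j, c i j • aeval v (pderiv j (f * X k)) =
        v k * (c i j • aeval v (pderiv j f)) + if j = k then c i j • aeval v f else 0 := by
      intro j
      rw [mul_comm f, pderiv_X_mul, map_add, map_mul, aeval_X, smul_add, mul_smul_comm]
      congr 1
      split_ifs <;> simp
    simp only [h1, Finset.sum_add_distrib, ← Finset.mul_sum, ← hf]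
    rw [map_mul, aeval_X, pderiv_mul, hv, mul_comm _ (v k), mul_comm _ (MvPolynomial.C _), C_mul']
    simp

/-- Stein's identity is stable under linear substitutions. -/
theorem IsStein.aeval_linear {L : MvPolynomial I ℝ →ₗ[ℝ] ℝ} (h : IsStein stdCov L)
    (c : I → J → ℝ) :
    IsStein (fun j k => ∑ i, c i j * c i k)
      (L ∘ₗ (aeval fun j => ∑ i, c i j • X i : MvPolynomial J ℝ →ₐ[ℝ] MvPolynomial I ℝ).toLinearMap)
    where
  one := by simp [h.one]
  X_mul j f := by
    have hv : ∀ i j, pderiv i ((fun j => ∑ i, c i j • X i : J → MvPolynomial I ℝ) j) =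
        MvPolynomial.C (c i j) := by
      intro i j
      simp [pderiv_X, Pi.single_apply, ← C_mul', map_sum]
    set v : J → MvPolynomial I ℝ := fun j => ∑ i, c i j • X i with hvdef
    have h1 : aeval v (X j * f) = ∑ i, c i j • (X i * aeval v f) := by
      rw [_root_.map_mul, aeval_X, hvdef, Finset.sum_mul]
      exact Finset.sum_congr rfl fun i _ => smul_mul_assoc _ _ _
    simp only [LinearMap.comp_apply, AlgHom.toLinearMap_apply, h1, map_sum, map_smul, h.X_mul,
      sum_stdCov_mul]
    simp only [smul_eq_mul, pderiv_aeval_linear v c hv, map_sum, map_smul, Finset.mul_sum,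
      Finset.sum_mul]
    rw [Finset.sum_comm]
    exact Finset.sum_congr rfl fun k _ => Finset.sum_congr rfl fun i _ => by ring

end Substitution

/-! ### The observations given all permutations but one -/

section Model

variable {n p : ℕ}

/-- The coefficients that express `H₀`, the weights of `G_j` and the noises of the other graphs
through independent variables, when the `j`-th hidden permutation is `σ`. -/
noncomputable def linkCoeff (ρ : ℝ) (j : Fin p) (σ : Equiv.Perm (Fin n)) :
    Edge n ⊕ Fin p × Edge n → Edge n ⊕ Fin p × Edge n → ℝ
  | Sum.inl e, Sum.inl e' => if e = e' then 1 else 0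
  | Sum.inl e, Sum.inr q => if q.1 = j ∧ permEdge σ q.2 = e then √ρ else 0
  | Sum.inr _, Sum.inl _ => 0
  | Sum.inr q, Sum.inr q' => if q = q' then (if q.1 = j then √(1 - ρ) else 1) else 0

theorem sum_linkCoeff_mul {ρ : ℝ} (h0 : 0 ≤ ρ) (h1 : ρ ≤ 1) (j : Fin p)
    (σ : Equiv.Perm (Fin n)) :
    (fun k l => ∑ i, linkCoeff ρ j σ i k * linkCoeff ρ j σ i l) =
      linkCov √ρ (Sum.inl ∘ permEdge σ) (fun e => Sum.inr (j, e)) := by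
  have hinj : ∀ e e' : Edge n, permEdge σ e = permEdge σ e' ↔ e = e' := fun e e' =>
    (MulAction.injective σ (β := Edge n)).eq_iff
  have hρ : √ρ * √ρ = ρ := Real.mul_self_sqrt h0
  have hρ' : √(1 - ρ) * √(1 - ρ) = 1 - ρ := Real.mul_self_sqrt (by linarith)
  funext k l
  rw [Fintype.sum_sum_type]
  rcases k with e | ⟨k, e⟩ <;> rcases l with e' | ⟨l, e'⟩
  · simp [linkCoeff, linkCov, stdCov, eq_comm]
  · by_cases hl : l = j
    · subst hl
      simp [linkCoeff, linkCov, stdCov, eq_comm]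
    · simp [linkCoeff, linkCov, stdCov, hl, Ne.symm hl]
  · by_cases hk : k = j
    · subst hk
      have h2 : ∀ x, (if permEdge σ x = e' then if x = e then (1 : ℝ) else 0 else 0) =
          if x = e then (if permEdge σ x = e' then 1 else 0) else 0 := by
        intro x
        split_ifs <;> rfl
      simp [linkCoeff, linkCov, stdCov, h2]
    · simp [linkCoeff, linkCov, stdCov, hk, Ne.symm hk]
  · by_cases hk : k = j
    · subst hk
      by_cases hl : l = k
      · subst hl
        by_cases he : e = e'
        · subst he
          simp [linkCoeff, linkCov, stdCov, hρ, hρ']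
        · simp [linkCoeff, linkCov, stdCov, he, Ne.symm he, hinj]
      · simp [linkCoeff, linkCov, stdCov, hl, Ne.symm hl]
    · by_cases hl : l = j
      · subst hl
        simp [linkCoeff, linkCov, stdCov, hk, Ne.symm hk]
      · by_cases h : k = l ∧ e = e'
        · obtain ⟨rfl, rfl⟩ := h
          simp [linkCoeff, linkCov, stdCov, hk, Ne.symm hk]
        · have h' : ¬(l = k ∧ e' = e) := fun h' => h ⟨h'.1.symm, h'.2.symm⟩
          simp [linkCoeff, linkCov, stdCov, hk, hl, Ne.symm hk, h, h']

/-- The observed weights with the hidden permutations other than the `j`-th one fixed, written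
through `H₀`, the weights of `G_j` and the noises of the other graphs. -/
noncomputable def partialObservation (ρ : ℝ) (j : Fin p) (π : Fin p → Equiv.Perm (Fin n))
    (q : Fin p × Edge n) : MvPolynomial (Edge n ⊕ Fin p × Edge n) ℝ :=
  if q.1 = j then X (Sum.inr q)
  else √ρ • X (Sum.inl (permEdge (π q.1) q.2)) + √(1 - ρ) • X (Sum.inr q)

theorem totalDegree_partialObservation_le (ρ : ℝ) (j : Fin p) (π : Fin p → Equiv.Perm (Fin n))
    (q : Fin p × Edge n) : (partialObservation ρ j π q).totalDegree ≤ 1 := by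
  unfold partialObservation
  split_ifs
  · simp
  · refine (totalDegree_add _ _).trans (max_le ?_ ?_) <;>
    exact (totalDegree_smul_le _ _).trans (by simp)

/-- The substituted polynomial does not depend on the `j`-th permutation, so that one and the same
`f` is tested against all `σ`. -/
theorem partialObservation_update (ρ : ℝ) (j : Fin p) (π : Fin p → Equiv.Perm (Fin n))
    (σ : Equiv.Perm (Fin n)) :
    partialObservation ρ j (Function.update π j σ) = partialObservation ρ j π := by
  funext q
  unfold partialObservation
  split_ifs with h
  · rfl
  · rw [Function.update_of_ne h]

theorem eval_observation (ρ : ℝ) (j : Fin p) (π : Fin p → Equiv.Perm (Fin n))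
    (x : (Edge n → ℝ) × (Fin p → Edge n → ℝ)) (f : MvPolynomial (Fin p × Edge n) ℝ) :
    eval (weights x) (aeval (fun k => ∑ i, linkCoeff ρ j (π j) i k • X i :
      Edge n ⊕ Fin p × Edge n → MvPolynomial (Edge n ⊕ Fin p × Edge n) ℝ)
      (aeval (partialObservation ρ j π) f)) = eval (observation ρ (π, x)) f := by
  induction f using MvPolynomial.induction_on with
  | C a => simp
  | add f g hf hg => simp only [map_add, hf, hg]
  | mul_X f q hf =>
    rw [map_mul, map_mul, map_mul, map_mul, hf]
    congr 1
    rw [aeval_X, eval_X, partialObservation]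
    obtain ⟨k, e⟩ := q
    by_cases hk : k = j
    · subst hk
      simp [linkCoeff, weights, observation, ite_and, smul_eval]
    · simp [linkCoeff, weights, observation, hk, ite_and, smul_eval]

/-- The average of a function of independent uniform permutations, by first averaging over one
of them. -/
theorem sum_update {α β : Type*} [Fintype α] [DecidableEq α] [Fintype β] [Nonempty β] (j : α)
    (F : (α → β) → ℝ) :
    ∑ π, F π = (Fintype.card β : ℝ)⁻¹ * ∑ π, ∑ σ, F (Function.update π j σ) := by
  have h0 : (Fintype.card β : ℝ) ≠ 0 := by exact_mod_cast Fintype.card_ne_zero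
  rw [← (Equiv.funSplitAt j β).symm.sum_comp, ← (Equiv.funSplitAt j β).symm.sum_comp,
    Fintype.sum_prod_type, Fintype.sum_prod_type]
  have h1 : ∀ (b σ : β) (g : {i // i ≠ j} → β),
      Function.update ((Equiv.funSplitAt j β).symm (b, g)) j σ =
        (Equiv.funSplitAt j β).symm (σ, g) := by
    intro b σ g
    ext i
    by_cases hi : i = j
    · subst hi
      simp
    · simp [hi]
  simp only [h1]
  rw [Finset.sum_const, Finset.card_univ, nsmul_eq_mul, inv_mul_cancel_left₀ h0, Finset.sum_comm]

end Model

/-! ### The mean squared error, entry by entry -/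

section MeanSquaredError

variable {n p : ℕ}

instance : DiscreteMeasurableSpace (Equiv.Perm (Fin n)) := ⟨fun _ => trivial⟩

theorem latentLaw_eq : latentLaw n p =
    (PMF.uniformOfFintype (Fin p → Equiv.Perm (Fin n))).toMeasure.prod (weightLaw n p) := rfl

/-- Integration over the latent variables: average over the hidden permutations, then integrate
over the weights. -/
theorem integral_latentLaw (F : Latent n p → ℝ)
    (hF : ∀ π, Integrable (fun x => F (π, x)) (weightLaw n p)) :
    Integrable F (latentLaw n p) ∧ ∫ ω, F ω ∂(latentLaw n p) =
      (Fintype.card (Fin p → Equiv.Perm (Fin n)) : ℝ)⁻¹ * ∑ π, ∫ x, F (π, x) ∂(weightLaw n p) := by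
  classical
  have h1 : F = fun ω => ∑ π, (if ω.1 = π then (1 : ℝ) else 0) * F (π, ω.2) := by
    funext ω
    simp
  have h2 : ∀ π : Fin p → Equiv.Perm (Fin n),
      Integrable (fun π' => if π' = π then (1 : ℝ) else 0)
        (PMF.uniformOfFintype (Fin p → Equiv.Perm (Fin n))).toMeasure := fun π => .of_finite
  have h3 : ∀ π, Integrable (fun ω : Latent n p => (if ω.1 = π then (1 : ℝ) else 0) * F (π, ω.2))
      (latentLaw n p) := fun π => (h2 π).mul_prod (hF π)
  refine ⟨by rw [h1]; exact integrable_finsetSum _ fun π _ => h3 π, ?_⟩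
  conv_lhs => rw [h1]
  rw [integral_finsetSum _ fun π _ => h3 π, Finset.mul_sum]
  refine Finset.sum_congr rfl fun π _ => ?_
  rw [latentLaw_eq, integral_prod_mul (fun π' => if π' = π then (1 : ℝ) else 0)
    (fun x => F (π, x)), PMF.integral_eq_sum]
  congr 1
  simp [PMF.uniformOfFintype_apply]

/-- The polynomial in the weights `H₀` and `Z` that gives the value of `f` on the observations. -/
noncomputable def weightPolynomial (ρ : ℝ) (j : Fin p) (π : Fin p → Equiv.Perm (Fin n))
    (f : MvPolynomial (Fin p × Edge n) ℝ) : MvPolynomial (Edge n ⊕ Fin p × Edge n) ℝ :=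
  aeval (fun k => ∑ i, linkCoeff ρ j (π j) i k • X i :
      Edge n ⊕ Fin p × Edge n → MvPolynomial (Edge n ⊕ Fin p × Edge n) ℝ)
    (aeval (partialObservation ρ j π) f)

theorem eval_weightPolynomial_sub_sq (ρ : ℝ) (j : Fin p) (π : Fin p → Equiv.Perm (Fin n))
    (f : MvPolynomial (Fin p × Edge n) ℝ) (c : ℝ) (x : (Edge n → ℝ) × (Fin p → Edge n → ℝ)) :
    eval (weights x) ((weightPolynomial ρ j π f - MvPolynomial.C c) *
      (weightPolynomial ρ j π f - MvPolynomial.C c)) =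
      (eval (observation ρ (π, x)) f - c) ^ 2 := by
  rw [map_mul, map_sub, eval_C, weightPolynomial, eval_observation, sq]

theorem integral_sq_error (ρ : ℝ) (f : MvPolynomial (Fin p × Edge n) ℝ) (a b : Fin n × Fin p) :
    Integrable (fun ω => (eval (observation ρ ω) f - alignmentMatrix ω a b) ^ 2) (latentLaw n p) ∧
    ∫ ω, (eval (observation ρ ω) f - alignmentMatrix ω a b) ^ 2 ∂(latentLaw n p) =
      (Fintype.card (Fin p → Equiv.Perm (Fin n)) : ℝ)⁻¹ * ∑ π : Fin p → Equiv.Perm (Fin n),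
        (hasGaussianMoments_weights (n := n) (p := p)).expectation
          ((weightPolynomial ρ a.2 π f -
              MvPolynomial.C (if π a.2 a.1 = π b.2 b.1 then 1 else 0)) *
            (weightPolynomial ρ a.2 π f -
              MvPolynomial.C (if π a.2 a.1 = π b.2 b.1 then 1 else 0))) := by
  have h1 : ∀ (π : Fin p → Equiv.Perm (Fin n)) x,
      (eval (observation ρ (π, x)) f - alignmentMatrix (π, x) a b) ^ 2 =
      eval (weights x) ((weightPolynomial ρ a.2 π f -
          MvPolynomial.C (if π a.2 a.1 = π b.2 b.1 then 1 else 0)) *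
        (weightPolynomial ρ a.2 π f -
          MvPolynomial.C (if π a.2 a.1 = π b.2 b.1 then 1 else 0))) := by
    intro π x
    rw [eval_weightPolynomial_sub_sq]
    rfl
  have h2 := integral_latentLaw
    (fun ω : Latent n p => (eval (observation ρ ω) f - alignmentMatrix ω a b) ^ 2) (by
      intro π
      simp only [h1]
      exact hasGaussianMoments_weights.integrable_eval _)
  refine ⟨h2.1, h2.2.trans ?_⟩
  simp only [h1]
  rfl

theorem mse_eq_sum (ρ : ℝ) (M : PolyEstimator n p) :
    mse ρ M = 1 / ((p : ℝ) * ((p : ℝ) - 1) * (n : ℝ) ^ 2) * ∑ a, ∑ b,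
      ∫ ω, (eval (observation ρ ω) (M a b) - alignmentMatrix ω a b) ^ 2 ∂(latentLaw n p) := by
  unfold mse
  congr 1
  rw [integral_finsetSum _ fun a _ => integrable_finsetSum _ fun b _ =>
    (integral_sq_error ρ (M a b) a b).1]
  refine Finset.sum_congr rfl fun a _ => ?_
  rw [integral_finsetSum _ fun b _ => (integral_sq_error ρ (M a b) a b).1]

theorem mse_nonneg (hp : 2 ≤ p) (ρ : ℝ) (M : PolyEstimator n p) : 0 ≤ mse ρ M := by
  have : (2 : ℝ) ≤ p := by exact_mod_cast hp
  unfold mse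
  refine mul_nonneg (one_div_nonneg.2 (mul_nonneg (mul_nonneg (by linarith) (by linarith))
    (sq_nonneg _))) (integral_nonneg fun ω => ?_)
  exact Finset.sum_nonneg fun a _ => Finset.sum_nonneg fun b _ => sq_nonneg _

theorem sum_sum_ite_ne (c : ℝ) :
    ∑ a : Fin n × Fin p, ∑ b : Fin n × Fin p, (if a.2 = b.2 then 0 else c) =
      (p : ℝ) * ((p : ℝ) - 1) * (n : ℝ) ^ 2 * c := by
  have h : ∀ a b : Fin n × Fin p,
      (if a.2 = b.2 then 0 else c) = c - if a.2 = b.2 then c else 0 := by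
    intro a b
    split_ifs <;> ring
  simp only [h, Finset.sum_sub_distrib, Fintype.sum_prod_type, Finset.sum_ite_eq, Finset.mem_univ,
    if_true, Finset.sum_const, Finset.card_univ, Fintype.card_fin, Fintype.card_prod, nsmul_eq_mul]
  push_cast
  ring

/-- The estimation error of each entry that relates two different graphs. -/
theorem entry_error_ge {ρ : ℝ} (h0 : 0 ≤ ρ) (h1 : ρ ≤ 1) {D : ℕ} {t : ℝ} (ht0 : 0 ≤ t)
    (ht1 : t ≤ 1) (hrt : 2 ≤ D → √ρ * (D : ℝ) ^ 2 ≤ t / 5) (hrD : D * √ρ ≤ 1 / 2)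
    {f : MvPolynomial (Fin p × Edge n) ℝ} (hf : f.totalDegree ≤ D) {a b : Fin n × Fin p}
    (hab : a.2 ≠ b.2) :
    1 / (n : ℝ) - 1 / (n : ℝ) ^ 2 - t ^ 2 / (n : ℝ) ^ 2 ≤
      ∫ ω, (eval (observation ρ ω) f - alignmentMatrix ω a b) ^ 2 ∂(latentLaw n p) := by
  -- Resampling the permutation of graph `a.2` reduces to a bound that holds for each choice of the
  -- other permutations; `π b.2 b.1` is then a constant.
  rw [(integral_sq_error ρ f a b).2, sum_update a.2]
  have hN : (0 : ℝ) < Fintype.card (Fin p → Equiv.Perm (Fin n)) := by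
    exact_mod_cast Fintype.card_pos
  rw [← div_eq_inv_mul, le_div_iff₀ hN, Finset.mul_sum, mul_comm, ← nsmul_eq_mul,
    ← Finset.card_univ]
  refine Finset.card_nsmul_le_sum _ _ _ fun π _ => ?_
  have h₀ := (hasGaussianMoments_weights (n := n) (p := p)).isStein
  have hinj : Function.Injective (Sum.elim (Sum.inl : Edge n → Edge n ⊕ Fin p × Edge n)
      fun e => Sum.inr (a.2, e)) := by
    rintro (e | e) (e' | e') h <;> simp_all
  have hS : ∀ σ : Equiv.Perm (Fin n), IsStein
      (linkCov √ρ (Sum.inl ∘ permEdge σ) (fun e => Sum.inr (a.2, e)))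
      ((hasGaussianMoments_weights (n := n) (p := p)).expectation ∘ₗ
        (aeval fun k => ∑ i, linkCoeff ρ a.2 σ i k • X i :
          MvPolynomial (Edge n ⊕ Fin p × Edge n) ℝ →ₐ[ℝ]
            MvPolynomial (Edge n ⊕ Fin p × Edge n) ℝ).toLinearMap) := by
    intro σ
    rw [← sum_linkCoeff_mul h0 h1]
    exact h₀.aeval_linear _
  have hdeg : (aeval (partialObservation ρ a.2 π) f).totalDegree ≤ D :=
    (totalDegree_aeval_le _ (totalDegree_partialObservation_le ρ a.2 π) f).trans hf
  refine (average_sq_error_ge h₀ hasGaussianMoments_weights.isMonotone hinj hS hdeg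
    (Real.sqrt_nonneg _) (Real.sqrt_le_one.2 h1) ht0 ht1 hrt hrD a.1 (π b.2 b.1)).trans
    (le_of_eq ?_)
  congr 1
  refine Finset.sum_congr rfl fun σ _ => ?_
  rw [LinearMap.comp_apply, AlgHom.toLinearMap_apply, map_mul, map_sub, aeval_C,
    ← MvPolynomial.algebraMap_eq, weightPolynomial, partialObservation_update,
    Function.update_self, Function.update_of_ne hab.symm]

theorem integrable_alignmentMatrix (a b : Fin n × Fin p) (π : Fin p → Equiv.Perm (Fin n)) :
    Integrable (fun x => alignmentMatrix (π, x) a b) (weightLaw n p) := by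
  change Integrable (fun _ => if π a.2 a.1 = π b.2 b.1 then (1 : ℝ) else 0) _
  exact integrable_const _

theorem integral_alignmentMatrix (a b : Fin n × Fin p) :
    ∫ ω, alignmentMatrix ω a b ∂(latentLaw n p) =
      (Fintype.card (Fin p → Equiv.Perm (Fin n)) : ℝ)⁻¹ * ∑ π : Fin p → Equiv.Perm (Fin n),
        if π a.2 a.1 = π b.2 b.1 then 1 else 0 := by
  have h := (integral_latentLaw (fun ω : Latent n p => alignmentMatrix ω a b)
    (integrable_alignmentMatrix a b)).2
  have h1 : ∀ (π : Fin p → Equiv.Perm (Fin n)) x,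
      alignmentMatrix (π, x) a b = if π a.2 a.1 = π b.2 b.1 then 1 else 0 := fun _ _ => rfl
  rw [h]
  simp only [h1, integral_const, probReal_univ, one_smul]

theorem integral_alignmentMatrix_of_ne {a b : Fin n × Fin p} (hab : a.2 ≠ b.2) :
    ∫ ω, alignmentMatrix ω a b ∂(latentLaw n p) = (n : ℝ)⁻¹ := by
  have hN : (Fintype.card (Fin p → Equiv.Perm (Fin n)) : ℝ) ≠ 0 := by
    exact_mod_cast Fintype.card_ne_zero
  rw [integral_alignmentMatrix, sum_update a.2]
  simp only [Function.update_self, Function.update_of_ne hab.symm,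
    Finset.mul_sum (s := Finset.univ (α := Fin p → Equiv.Perm (Fin n)))]
  simp only [average_indicator]
  simp

theorem entry_error_trivialEstimator (ρ : ℝ) (a b : Fin n × Fin p) :
    ∫ ω, (eval (observation ρ ω) (trivialEstimator n p a b) - alignmentMatrix ω a b) ^ 2
      ∂(latentLaw n p) = if a.2 = b.2 then 0 else 1 / (n : ℝ) - 1 / (n : ℝ) ^ 2 := by
  have hN : (Fintype.card (Fin p → Equiv.Perm (Fin n)) : ℝ) ≠ 0 := by
    exact_mod_cast Fintype.card_ne_zero
  set m := ∫ ω, alignmentMatrix ω a b ∂(latentLaw n p) with hm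
  have h1 : ∀ ω : Latent n p, eval (observation ρ ω) (trivialEstimator n p a b) = m := by
    intro ω
    simp [trivialEstimator, hm]
  have h2 : ∀ ω : Latent n p, (m - alignmentMatrix ω a b) ^ 2 =
      m ^ 2 + (1 - 2 * m) * alignmentMatrix ω a b := by
    intro ω
    simp only [alignmentMatrix, Matrix.of_apply]
    split_ifs <;> ring
  simp only [h1, h2]
  have h3 := (integral_latentLaw (fun ω : Latent n p => alignmentMatrix ω a b)
    (integrable_alignmentMatrix a b)).1
  have h4 := (integral_latentLaw (fun _ : Latent n p => m ^ 2) (fun π => integrable_const _))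
  rw [integral_add h4.1 (h3.const_mul _), integral_const_mul, ← hm, h4.2]
  simp only [integral_const, probReal_univ, one_smul, Finset.sum_const, Finset.card_univ,
    nsmul_eq_mul]
  rw [inv_mul_cancel_left₀ hN]
  split_ifs with hab
  · rw [integral_alignmentMatrix, hab] at hm
    by_cases hu : a.1 = b.1
    · have : m = 1 := by
        rw [hm]
        simp [hu]
      rw [this]
      norm_num
    · have : m = 0 := by
        rw [hm]
        simp [hu]
      rw [this]
      norm_num
  · rw [hm, integral_alignmentMatrix_of_ne hab]
    ring

theorem mse_trivialEstimator (hn : 1 ≤ n) (hp : 2 ≤ p) (ρ : ℝ) :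
    mse ρ (trivialEstimator n p) = 1 / (n : ℝ) - 1 / (n : ℝ) ^ 2 := by
  have h1 : (2 : ℝ) ≤ p := by exact_mod_cast hp
  have h2 : (1 : ℝ) ≤ n := by exact_mod_cast hn
  have h3 : (p : ℝ) * ((p : ℝ) - 1) * (n : ℝ) ^ 2 ≠ 0 :=
    mul_ne_zero (mul_ne_zero (by linarith) (by linarith)) (by positivity)
  simp only [mse_eq_sum, entry_error_trivialEstimator, sum_sum_ite_ne]
  rw [one_div, inv_mul_cancel_left₀ h3]

theorem mmse_le (hn : 1 ≤ n) (hp : 2 ≤ p) (ρ : ℝ) (D : ℕ) :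
    mmse n p ρ D ≤ 1 / (n : ℝ) - 1 / (n : ℝ) ^ 2 := by
  rw [← mse_trivialEstimator hn hp ρ]
  refine ciInf_le (f := fun M : {M : PolyEstimator n p // ∀ a b, (M a b).totalDegree ≤ D} =>
    mse ρ M.1) ⟨0, ?_⟩ ⟨trivialEstimator n p, fun a b => by simp [trivialEstimator]⟩
  rintro _ ⟨M, rfl⟩
  exact mse_nonneg hp ρ M.1

/-- A lower bound for the low-degree error, without restriction on the size of the graphs. -/
theorem mmse_ge (hn : 1 ≤ n) (hp : 2 ≤ p) {ρ : ℝ} (h0 : 0 ≤ ρ) (h1 : ρ ≤ 1) {D : ℕ} {t : ℝ}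
    (ht0 : 0 ≤ t) (ht1 : t ≤ 1) (hrt : 2 ≤ D → √ρ * (D : ℝ) ^ 2 ≤ t / 5)
    (hrD : D * √ρ ≤ 1 / 2) :
    1 / (n : ℝ) - 1 / (n : ℝ) ^ 2 - t ^ 2 / (n : ℝ) ^ 2 ≤ mmse n p ρ D := by
  have hp' : (2 : ℝ) ≤ p := by exact_mod_cast hp
  have hn' : (1 : ℝ) ≤ n := by exact_mod_cast hn
  have hpos : 0 < (p : ℝ) * ((p : ℝ) - 1) * (n : ℝ) ^ 2 :=
    mul_pos (mul_pos (by linarith) (by linarith)) (by positivity)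
  have : Nonempty {M : PolyEstimator n p // ∀ a b, (M a b).totalDegree ≤ D} :=
    ⟨⟨0, fun a b => by simp⟩⟩
  refine le_ciInf ?_
  rintro ⟨M, hM⟩
  change _ ≤ mse ρ M
  -- The normalization counts exactly the entries between different graphs; the entries within one
  -- graph are bounded below by `0`.
  rw [mse_eq_sum, one_div_mul_eq_div, le_div_iff₀ hpos, mul_comm, ← sum_sum_ite_ne]
  refine Finset.sum_le_sum fun a _ => Finset.sum_le_sum fun b _ => ?_
  split_ifs with hab
  · exact integral_nonneg fun ω => sq_nonneg _
  · exact entry_error_ge h0 h1 ht0 ht1 hrt hrD (hM a b) hab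

end MeanSquaredError

/-! ### The polylogarithmic regime -/

section Asymptotics

open Filter Topology

theorem tendsto_sqrt_mul_sq {η : ℝ} (hη : 0 < η) {x ρ : ℕ → ℝ} {D : ℕ → ℕ}
    (hx : Tendsto x atTop atTop) (hρ0 : ∀ k, 0 ≤ ρ k)
    (hD : Asymptotics.IsBigO atTop (fun k => (D k : ℝ)) fun k => x k ^ (1 + η))
    (hρ : Asymptotics.IsLittleO atTop ρ fun k => 1 / x k ^ (7 * (1 + η))) :
    Tendsto (fun k => √(ρ k) * (D k : ℝ) ^ 2) atTop (𝓝 0) := by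
  have h1 : Asymptotics.IsLittleO atTop (fun k => ρ k * (D k : ℝ) ^ 4) fun _ => (1 : ℝ) := by
    refine (hρ.mul_isBigO (hD.pow 4)).trans_isBigO ?_
    refine Asymptotics.IsBigO.of_bound 1 ?_
    filter_upwards [hx.eventually_ge_atTop 1] with k hk
    have hx0 : 0 < x k := by linarith
    rw [← Real.rpow_natCast, ← Real.rpow_mul hx0.le, one_div_mul_eq_div, norm_one, mul_one,
      Real.norm_of_nonneg (by positivity), div_le_one (by positivity)]
    -- `D^4` costs the exponent `4 (1 + η)`, well within the available `7 (1 + η)`.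
    refine Real.rpow_le_rpow_of_exponent_le hk ?_
    push_cast
    nlinarith
  have h2 : Tendsto (fun k => √(ρ k * (D k : ℝ) ^ 4)) atTop (𝓝 0) := by
    simpa using ((Asymptotics.isLittleO_one_iff ℝ).1 h1).sqrt
  refine h2.congr fun k => ?_
  rw [Real.sqrt_mul (hρ0 k), show (D k : ℝ) ^ 4 = ((D k : ℝ) ^ 2) ^ 2 by ring,
    Real.sqrt_sq (by positivity)]

end Asymptotics

/-! ### The bound in terms of `ζ` -/

section LowerBound

theorem le_zeta {n D : ℕ} {ρ : ℝ} (hn : D + 2 ≤ n) (hρ : ρ < 1) :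
    2 * ((D : ℝ) ^ 3 * √ρ) * √(1 + (D : ℝ) / 2) ≤ zeta n D ρ := by
  have hs : √ρ < 1 := (Real.sqrt_lt' one_pos).2 (by simpa using hρ)
  have hn' : (D : ℝ) + 2 ≤ n := by exact_mod_cast hn
  have hn0 : (0 : ℝ) < n := by linarith [(Nat.cast_nonneg D : (0 : ℝ) ≤ D)]
  have h1 : ((D : ℝ) + 1) / n < 1 := (div_lt_one hn0).2 (by linarith)
  have h2 : 0 ≤ ((D : ℝ) + 1) / n := by positivity
  have h3 : 2 ≤ 2 / (1 - ((D : ℝ) + 1) / n) ^ 2 := by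
    rw [le_div_iff₀ (pow_pos (by linarith) 2)]
    have : (1 - ((D : ℝ) + 1) / n) ^ 2 ≤ 1 := pow_le_one₀ (by linarith) (by linarith)
    linarith
  have h4 : (D : ℝ) ^ 3 * √ρ ≤ (D : ℝ) ^ 3 * √ρ / (1 - √ρ) := by
    refine le_div_self (by positivity) (by linarith) ?_
    linarith [Real.sqrt_nonneg ρ]
  unfold zeta
  calc _ = (D : ℝ) ^ 3 * √ρ * √(1 + (D : ℝ) / 2) * 2 := by ring
    _ ≤ _ := by gcongr

theorem mmse_ge_zeta {n p D : ℕ} {ρ : ℝ} (hp : 2 ≤ p) (hn : D + 2 ≤ n) (h0 : 0 ≤ ρ) (h1 : ρ < 1)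
    (hζ : zeta n D ρ < 1) :
    1 / (n : ℝ) - 1 / (n : ℝ) ^ 2 - 2 / ((n : ℝ) - 1 - (D : ℝ)) ^ 2 *
      (zeta n D ρ * ((1 + zeta n D ρ) / (1 - zeta n D ρ))) ≤ mmse n p ρ D := by
  have hle := le_zeta hn h1
  set z := zeta n D ρ
  have hs0 := Real.sqrt_nonneg ρ
  have hS : 1 ≤ √(1 + (D : ℝ) / 2) := Real.one_le_sqrt.2 (by
    have : (0 : ℝ) ≤ D := Nat.cast_nonneg D
    linarith)
  have hz2 : 2 * ((D : ℝ) ^ 3 * √ρ) ≤ z :=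
    (le_mul_of_one_le_right (by positivity) hS).trans hle
  have hz0 : 0 ≤ z := le_trans (by positivity) hz2
  have hrD : D * √ρ ≤ 1 / 2 := by
    have h2 : (D : ℝ) ≤ (D : ℝ) ^ 3 := by exact_mod_cast Nat.le_self_pow (by norm_num) D
    have := mul_le_mul_of_nonneg_right h2 hs0
    linarith
  have hrt : 2 ≤ D → √ρ * (D : ℝ) ^ 2 ≤ z / 5 := by
    intro hD
    have hD' : (2 : ℝ) ≤ D := by exact_mod_cast hD
    -- For `D ≥ 2` the root is at least `√2 ≥ 5/4`. With `D^3 ≥ 2 D^2` and the factor `2` of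
    -- `le_zeta` this yields exactly the factor `5` required of `t = ζ`.
    have hS' : 5 / 4 ≤ √(1 + (D : ℝ) / 2) := Real.le_sqrt_of_sq_le (by linarith)
    have h2 : 2 * (√ρ * (D : ℝ) ^ 2) ≤ (D : ℝ) ^ 3 * √ρ := by
      have : 0 ≤ √ρ * (D : ℝ) ^ 2 := by positivity
      nlinarith
    have h3 : 2 * (2 * (√ρ * (D : ℝ) ^ 2)) * (5 / 4) ≤ z :=
      (mul_le_mul (by linarith) hS' (by norm_num) (by positivity)).trans hle
    linarith
  refine le_trans ?_ (mmse_ge (by omega) hp h0 h1.le hz0 hζ.le hrt hrD)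
  have hn' : (D : ℝ) + 2 ≤ n := by exact_mod_cast hn
  have hD0 : (0 : ℝ) ≤ D := Nat.cast_nonneg D
  have h4 : z ≤ (1 + z) / (1 - z) := by
    rw [le_div_iff₀ (by linarith)]
    nlinarith
  have h5 : z ^ 2 / (n : ℝ) ^ 2 ≤ 2 / ((n : ℝ) - 1 - (D : ℝ)) ^ 2 * (z * ((1 + z) / (1 - z))) := by
    rw [div_eq_inv_mul, sq z]
    refine mul_le_mul ?_ (mul_le_mul_of_nonneg_left h4 hz0) (by positivity) (by positivity)
    rw [inv_eq_one_div]
    refine div_le_div₀ (by norm_num) (by norm_num) (pow_pos (by linarith) 2) ?_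
    exact pow_le_pow_left₀ (by linarith) (by linarith) 2
  linarith

end LowerBound

end GraphAlignment

theorem theorem5 :
    -- the non-asymptotic lower bound
    (∀ (n p D : ℕ) (ρ : ℝ), 2 ≤ p → D + 2 ≤ n → 0 ≤ ρ → ρ < 1 →
      GraphAlignment.zeta n D ρ < 1 →
      GraphAlignment.mmse n p ρ D ≥
        1 / (n : ℝ) - 1 / (n : ℝ) ^ 2 -
          2 / ((n : ℝ) - 1 - (D : ℝ)) ^ 2 *
            (GraphAlignment.zeta n D ρ * ((1 + GraphAlignment.zeta n D ρ) /
              (1 - GraphAlignment.zeta n D ρ)))) ∧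
    -- the error of the trivial estimator
    (∀ (n p : ℕ) (ρ : ℝ), 1 ≤ n → 2 ≤ p → 0 ≤ ρ → ρ ≤ 1 →
      GraphAlignment.mse ρ (GraphAlignment.trivialEstimator n p) =
        1 / (n : ℝ) - 1 / (n : ℝ) ^ 2) ∧
    -- polynomials of degree polylogarithmic in `n p` do not improve on it
    (∀ (η : ℝ), 0 < η → ∀ (n p D : ℕ → ℕ) (ρ : ℕ → ℝ),
      (∀ k, 1 ≤ n k) → (∀ k, 2 ≤ p k) → (∀ k, 0 ≤ ρ k ∧ ρ k ≤ 1) →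
      Filter.Tendsto (fun k => n k * p k) Filter.atTop Filter.atTop →
      Asymptotics.IsBigO Filter.atTop (fun k => (D k : ℝ))
        (fun k => Real.log ((n k : ℝ) * (p k : ℝ)) ^ (1 + η)) →
      Asymptotics.IsLittleO Filter.atTop ρ
        (fun k => 1 / Real.log ((n k : ℝ) * (p k : ℝ)) ^ (7 * (1 + η))) →
      ∃ ε : ℕ → ℝ, Filter.Tendsto ε Filter.atTop (nhds 0) ∧
        ∀ k, GraphAlignment.mmse (n k) (p k) (ρ k) (D k) =
          1 / (n k : ℝ) - 1 / (n k : ℝ) ^ 2 * (1 + ε k)) := by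
  refine ⟨fun n p D ρ hp hn h0 h1 hζ => GraphAlignment.mmse_ge_zeta hp hn h0 h1 hζ,
    fun n p ρ hn hp _ _ => GraphAlignment.mse_trivialEstimator hn hp ρ, ?_⟩
  intro η hη n p D ρ hn hp hρ hnp hD hρo
  have hx : Filter.Tendsto (fun k => Real.log ((n k : ℝ) * (p k : ℝ))) Filter.atTop
      Filter.atTop := by
    refine Real.tendsto_log_atTop.comp ?_
    refine (tendsto_natCast_atTop_atTop.comp hnp).congr fun k => ?_
    simp
  have ht := GraphAlignment.tendsto_sqrt_mul_sq hη hx (fun k => (hρ k).1) hD hρo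
  -- The smallest `t` allowed by `mmse_ge` when `D ≥ 2`.
  set t : ℕ → ℝ := fun k => 5 * (Real.sqrt (ρ k) * (D k : ℝ) ^ 2) with htdef
  have ht' : Filter.Tendsto t Filter.atTop (nhds 0) := by
    simpa using ht.const_mul 5
  have ht2 : Filter.Tendsto (fun k => t k ^ 2) Filter.atTop (nhds 0) := by
    simpa using ht'.pow 2
  -- The error `ε` is obtained by solving the claimed identity. The trivial estimator gives `0 ≤ ε`,
  -- and `mmse_ge` gives `ε ≤ t ^ 2` as soon as `t ≤ 1`.
  refine ⟨fun k => (n k : ℝ) ^ 2 *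
    (1 / (n k : ℝ) - GraphAlignment.mmse (n k) (p k) (ρ k) (D k)) - 1, ?_, fun k => ?_⟩
  · refine tendsto_of_tendsto_of_tendsto_of_le_of_le' tendsto_const_nhds ht2 ?_ ?_
    · refine Filter.Eventually.of_forall fun k => ?_
      have hn0 : (0 : ℝ) < n k := by exact_mod_cast hn k
      have h := mul_le_mul_of_nonneg_left
        (GraphAlignment.mmse_le (hn k) (hp k) (ρ k) (D k)) (sq_nonneg (n k : ℝ))
      have h2 : (n k : ℝ) ^ 2 * (1 / (n k : ℝ) ^ 2) = 1 := by field_simp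
      simp only [mul_sub, h2] at h ⊢
      linarith
    · filter_upwards [ht'.eventually_le_const one_pos] with k hk
      have hn0 : (0 : ℝ) < n k := by exact_mod_cast hn k
      have hs0 := Real.sqrt_nonneg (ρ k)
      have hDk : (D k : ℝ) ≤ (D k : ℝ) ^ 2 := by
        exact_mod_cast Nat.le_self_pow (by norm_num) (D k)
      have hrD : (D k : ℝ) * Real.sqrt (ρ k) ≤ 1 / 2 := by
        have := mul_le_mul_of_nonneg_right hDk hs0
        simp only [htdef] at hk
        linarith
      have h := mul_le_mul_of_nonneg_left
        (GraphAlignment.mmse_ge (hn k) (hp k) (hρ k).1 (hρ k).2 (t := t k) (D := D k)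
          (by simp only [htdef]; positivity) hk (fun _ => by simp only [htdef]; linarith) hrD)
        (sq_nonneg (n k : ℝ))
      have h2 : (n k : ℝ) ^ 2 * (1 / (n k : ℝ) ^ 2) = 1 := by field_simp
      have h3 : (n k : ℝ) ^ 2 * (t k ^ 2 / (n k : ℝ) ^ 2) = t k ^ 2 := by field_simp
      simp only [mul_sub, h2, h3] at h ⊢
      linarith
  · have hn0 : (n k : ℝ) ≠ 0 := by
      have := hn k
      positivity
    field_simp
    ring
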